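/- All graphs are finite, simple and undirected. A representation of a group $G$ on a graph $X$ is a homomorphism $G \to \mathrm{Aut}(X)$; $G$ is representable on $X$ if it has a nontrivial representation on $X$, that is, one that does not send every element to the identity. (1) Let $X$ and $Y$ be connected graphs on $n$ vertices each, let $p > n$ be a prime, and let $Z$ be the disjoint union of $p-1$ copies of $X$ and one copy of $Y$. Then the cyclic group $\mathbb{Z}/p\mathbb{Z}$ is representable on $Z$ if and only if $X \cong Y$. (2) The graph isomorphism problem (given two graphs $X$ and $Y$, not necessarily connected, decide whether $X \cong Y$) is logspace many-one reducible to the abelian group representability problem (given a finite abelian group $G$ by its multiplication table and a graph $X$, decide whether $G$ is representable on $X$). It is even logspace many-one reducible to the restriction of this problem to cyclic groups $G$ of prime order. Here problems are encoded over binary words, graphs by adjacency matrices and groups by multiplication tables. A logspace many-one reduction from $A$ to $B$ is a function $f$ on binary words such that $w$ encodes a yes-instance of $A$ if and only if $f(w)$ encodes a yes-instance of $B$, such that $f$ sends encodings of instances of $A$ to encodings of instances of $B$, and such that $f$ is computed by a deterministic Turing machine with a read-only input tape, a write-only output tape and read-write work tapes, which halts on every input $w$ and uses $O(\log |w|)$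 work tape cells. -/

import Mathlib

/-! ### Representations of groups on graphs -/

/-- A representation of `G` on the graph `X`: a homomorphism from `G` to the automorphism group
of `X`. -/
abbrev GraphRep (G : Type*) [Group G] {V : Type*} (X : SimpleGraph V) : Type _ :=
  G →* (X ≃g X)

/-- `G` is representable on `X` if it has a nontrivial representation on `X`. -/
def Representable (G : Type*) [Group G] {V : Type*} (X : SimpleGraph V) : Prop :=
  ∃ ρ : GraphRep G X, ∃ g : G, ρ g ≠ 1

/-- The disjoint union of `k` copies of the graph `X`. -/
def graphCopies (k : ℕ) {V : Type*} (X : SimpleGraph V) : SimpleGraph (Fin k × V) where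
  Adj a b := a.1 = b.1 ∧ X.Adj a.2 b.2
  symm := ⟨fun _ _ h => ⟨h.1.symm, h.2.symm⟩⟩
  loopless := ⟨fun _ h => h.2.ne rfl⟩

/-! ### Logarithmic space

A deterministic Turing machine with a two-way read-only input tape (between end markers), finitely
many read-write work tapes, infinite to the right, and a write-only output tape. Only the cells of
the work tapes are counted. -/

/-- Head movements. -/
inductive HeadMove where
  | left
  | stay
  | right

/-- What the input head can see: an end marker or an input bit. -/
inductive InputCell where
  | leftEnd
  | bit (b : Bool)
  | rightEnd

/-- The effect of one step of a machine. -/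
structure TransducerAction (State Sym : Type) (tapes : ℕ) where
  /-- the next state -/
  next : State
  /-- the movement of the input head -/
  inputMove : HeadMove
  /-- the symbols written on the scanned cells of the work tapes -/
  write : Fin tapes → Sym
  /-- the movements of the work heads (made after writing) -/
  workMove : Fin tapes → HeadMove
  /-- the bit appended to the output, if any -/
  emit : Option Bool

/-- Turing transducers over the binary input and output alphabet; the machine halts when the
transition function is `none`. -/
structure Transducer where
  State : Type
  finite_state : Finite State
  Sym : Type
  finite_sym : Finite Sym
  blank : Sym
  tapes : ℕ
  start : State
  trans : State → InputCell → (Fin tapes → Sym) → Option (TransducerAction State Sym tapes)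

/-- Moving a head on a tape with cells `0, 1, 2, …`; at cell `0` a left move has no effect. -/
def HeadMove.apply : HeadMove → ℕ → ℕ
  | .left, i => i - 1
  | .stay, i => i
  | .right, i => i + 1

/-- Cell `i` of the input tape that carries `w`: cell `0` is the left end marker, the cells
`1, …, w.length` carry the bits of `w`, and cell `w.length + 1` is the right end marker. -/
def inputCell (w : List Bool) : ℕ → InputCell
  | 0 => .leftEnd
  | i + 1 => match w[i]? with
    | some b => .bit b
    | none => .rightEnd

namespace Transducer

/-- Configurations of a transducer (the input word is kept separately). -/
structure Cfg (M : Transducer) where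
  state : M.State
  /-- position of the input head -/
  inputPos : ℕ
  /-- contents of the work tapes -/
  work : Fin M.tapes → ℕ → M.Sym
  /-- positions of the work heads -/
  head : Fin M.tapes → ℕ
  /-- the output written so far -/
  out : List Bool

/-- The initial configuration: blank work tapes, empty output, all heads at cell `0`. -/
def startCfg (M : Transducer) : M.Cfg where
  state := M.start
  inputPos := 0
  work := fun _ _ => M.blank
  head := fun _ => 0
  out := []

/-- One step on input `w`. The input head does not move beyond the right end marker. -/
def step (M : Transducer) (w : List Bool) (c : M.Cfg) : Option M.Cfg :=
  (M.trans c.state (inputCell w c.inputPos) (fun t => c.work t (c.head t))).map fun a =>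
    { state := a.next
      inputPos := min (a.inputMove.apply c.inputPos) (w.length + 1)
      work := fun t => Function.update (c.work t) (c.head t) (a.write t)
      head := fun t => (a.workMove t).apply (c.head t)
      out := c.out ++ a.emit.toList }

/-- On input `w` the machine `M` halts with output `v`. -/
def Outputs (M : Transducer) (w v : List Bool) : Prop :=
  ∃ c : M.Cfg, StateTransition.Reaches (M.step w) M.startCfg c ∧ M.step w c = none ∧ c.out = v

/-- On input `w`, the machine `M` only ever visits the first `s` cells of each work tape. -/
def UsesSpace (M : Transducer) (w : List Bool) (s : ℕ) : Prop :=
  ∀ c : M.Cfg, StateTransition.Reaches (M.step w) M.startCfg c → ∀ t, c.head t < s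

end Transducer

/-- `f` is computed by a transducer that halts on every input `w` and uses
`O(log |w|)` cells of its work tapes. -/
def LogspaceComputable (f : List Bool → List Bool) : Prop :=
  ∃ (M : Transducer) (C : ℕ), ∀ w : List Bool,
    M.Outputs w (f w) ∧ M.UsesSpace w (C * (Nat.log 2 w.length + 1))

/-! ### Decision problems and reductions -/

/-- A decision problem over binary words: the words that encode an instance, and among these the
words that encode an instance whose answer is yes. -/
structure DecisionProblem where
  inst : Set (List Bool)
  yes : Set (List Bool)
  yes_subset : yes ⊆ inst

/-- Logspace many-one reducibility: a logspace computable `f` with `w ∈ A ↔ f w ∈ B` for all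
words `w`, which moreover sends (encodings of) instances of `A` to (encodings of) instances
of `B`. -/
def LogspaceReduces (A B : DecisionProblem) : Prop :=
  ∃ f : List Bool → List Bool, LogspaceComputable f ∧
    (∀ w, w ∈ A.yes ↔ f w ∈ B.yes) ∧ (∀ w ∈ A.inst, f w ∈ B.inst)

/-- `1ᵏ0` -/
def encodeUnary (k : ℕ) : List Bool :=
  List.replicate k true ++ [false]

open Classical in
/-- A graph on `{0, …, n-1}` is encoded by `1ⁿ0` followed by its adjacency matrix, row by row. -/
noncomputable def encodeGraph {n : ℕ} (X : SimpleGraph (Fin n)) : List Bool :=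
  encodeUnary n ++
    (List.finRange n).flatMap fun i => (List.finRange n).map fun j => decide (X.Adj i j)

/-- A finite group `G` with elements enumerated by `e` is encoded by `1ᵏ0`, where `k` is its order,
followed by its multiplication table, row by row, with the entries in unary. -/
def encodeGroup {k : ℕ} {G : Type} [Group G] (e : G ≃ Fin k) : List Bool :=
  encodeUnary k ++
    (List.finRange k).flatMap fun i => (List.finRange k).flatMap fun j =>
      encodeUnary (e (e.symm i * e.symm j)).val

/-- Graph isomorphism: given finite graphs `X` and `Y`, are they isomorphic? -/
def graphIsomorphism : DecisionProblem where
  inst := {w | ∃ (n m : ℕ) (X : SimpleGraph (Fin n)) (Y : SimpleGraph (Fin m)),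
    w = encodeGraph X ++ encodeGraph Y}
  yes := {w | ∃ (n m : ℕ) (X : SimpleGraph (Fin n)) (Y : SimpleGraph (Fin m)),
    w = encodeGraph X ++ encodeGraph Y ∧ Nonempty (X ≃g Y)}
  yes_subset := fun _ ⟨n, m, X, Y, h, _⟩ => ⟨n, m, X, Y, h⟩

/-- Group representability for the groups of a class `𝒞`: given a finite group `G` in `𝒞`, by its
multiplication table, and a finite graph `X`, is `G` representable on `X`? -/
def groupRepresentability (𝒞 : ∀ (G : Type) [Group G], Prop) : DecisionProblem where
  inst := {w | ∃ (k m : ℕ) (G : Type) (_ : Group G) (e : G ≃ Fin k) (X : SimpleGraph (Fin m)),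
    w = encodeGroup e ++ encodeGraph X ∧ 𝒞 G}
  yes := {w | ∃ (k m : ℕ) (G : Type) (_ : Group G) (e : G ≃ Fin k) (X : SimpleGraph (Fin m)),
    w = encodeGroup e ++ encodeGraph X ∧ 𝒞 G ∧ Representable G X}
  yes_subset := fun _ ⟨k, m, G, i, e, X, h, hC, _⟩ => ⟨k, m, G, i, e, X, h, hC⟩

/-- Abelian group representability. -/
def abelianRepresentability : DecisionProblem :=
  groupRepresentability fun G _ => ∀ a b : G, a * b = b * a

/-- Representability of cyclic groups of prime order. -/
def primeCyclicRepresentability : DecisionProblem :=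
  groupRepresentability fun G _ => IsCyclic G ∧ (Nat.card G).Prime

/-! ### Permutations of prime order on small sets -/

/-! The criterion. A nontrivial representation of `ZMod p` provides an automorphism `σ ≠ 1` with `σ
^ p = 1`, and `σ` permutes the `p` connected components. If it moves `Y` onto a copy of `X`, then `X
≅ Y`, as both have `n` vertices. Otherwise it maps `Y` to itself and permutes the `p - 1` copies of
`X`. A map with `p`-th iterate `id` on fewer than `p` points is the identity
(`Function.eq_id_of_iterate_prime`). Applied to the set of copies and then, because `n < p`, to each
component, this gives `σ = 1`, a contradiction (`nonempty_iso_of_representable`). Conversely, if `X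
≅ Y`, the `p` components are isomorphic and can be shifted cyclically (`representable_glue_self`).

The reduction. Graphs with different numbers of vertices are not isomorphic, and the empty graph is
then a suitable output. For graphs on `n` vertices each, connectedness is forced by passing to
cones, which neither creates nor destroys isomorphisms (`nonempty_cone_iso_iff`). Cones have `n + 1`
vertices, and Bertrand's postulate supplies a prime `p` with `n + 1 < p ≤ 2 * (n + 1)`, so that a
bounded search finds one and the output has polynomial length. Malformed input gives the empty word,
which encodes no instance. Since codes determine group and graph up to isomorphism (`encode_inj`),
the answer on the output does not depend on how it is decoded.

Logarithmic space. The reduction is written in a small language: arithmetic with bounded search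
(`Ex`), and bounded loops that write bits (`WordProg`). A program has a fixed number of registers,
and their values are at most a fixed power of the input length plus two. Hence binary counters with
`O(log |w|)` digits suffice, one on each work tape. The language is compiled to operations on
registers, these to composable machine fragments, and these to transducers
(`WordProg.logspaceComputable`). -/

theorem Function.eq_id_of_iterate_prime {α : Type*} [Fintype α] {p : ℕ} (hp : p.Prime)
    (hcard : Fintype.card α < p) {f : α → α} (hf : f^[p] = id) : f = id := by
  classical
  obtain ⟨q, rfl⟩ : ∃ q, p = q + 1 := ⟨p - 1, by have := hp.pos; omega⟩
  let σ : Equiv.Perm α :=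
    { toFun := f
      invFun := f^[q]
      left_inv := fun x => by
        have := congrFun hf x
        rwa [Function.iterate_succ_apply] at this
      right_inv := fun x => by
        have := congrFun hf x
        rwa [Function.iterate_succ_apply'] at this }
  have hσ : σ ^ (q + 1) = 1 := by
    ext x
    rw [← Equiv.Perm.iterate_eq_pow]
    exact congrFun hf x
  -- The order divides the prime. If it were the prime itself, Lagrange's theorem would make that
  -- prime divide `(Fintype.card α)!`, although it exceeds every factor.
  have hone : orderOf σ = 1 := by
    rcases (Nat.dvd_prime hp).1 (orderOf_dvd_of_pow_eq_one hσ) with h | h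
    · exact h
    · have hdvd : q + 1 ∣ (Fintype.card α).factorial := by
        rw [← Fintype.card_perm, ← h]
        exact orderOf_dvd_card
      exact absurd ((Nat.Prime.dvd_factorial hp).1 hdvd) (by omega)
  rw [orderOf_eq_one_iff] at hone
  funext x
  exact congrArg (fun τ : Equiv.Perm α => τ x) hone

/-! ### Transport of representability -/

theorem Representable.of_iso {G : Type*} [Group G] {V W : Type*} {X : SimpleGraph V}
    {Y : SimpleGraph W} (φ : X ≃g Y) (h : Representable G X) : Representable G Y := by
  obtain ⟨ρ, g, hg⟩ := h
  refine ⟨⟨⟨fun a => (φ.symm.trans (ρ a)).trans φ, ?_⟩, ?_⟩, g, fun h => hg ?_⟩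
  · ext y
    simp
  · intro a b
    ext y
    simp
  · ext x
    have := congrArg (fun τ : Y ≃g Y => φ.symm (τ (φ x))) h
    simpa using this

theorem Representable.of_mulEquiv {G H : Type*} [Group G] [Group H] (e : G ≃* H) {V : Type*}
    {X : SimpleGraph V} (h : Representable G X) : Representable H X := by
  obtain ⟨ρ, g, hg⟩ := h
  exact ⟨ρ.comp e.symm.toMonoidHom, e g, by simpa using hg⟩

theorem not_representable_of_isEmpty {G : Type*} [Group G] {V : Type*} [IsEmpty V]
    (X : SimpleGraph V) : ¬ Representable G X := by
  rintro ⟨ρ, g, hg⟩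
  exact hg (by ext v; exact isEmptyElim v)

/-! ### Copies of a graph together with one more graph -/

/-- The disjoint union of `q` copies of `X` and one copy of `Y`, for graphs on the same
vertex type. -/
def glue (q : ℕ) {V : Type*} (X Y : SimpleGraph V) : SimpleGraph (Fin (q + 1) × V) where
  Adj a b := a.1 = b.1 ∧ (if a.1 = Fin.last q then Y else X).Adj a.2 b.2
  symm := ⟨fun a b h => ⟨h.1.symm, by rw [← h.1]; exact h.2.symm⟩⟩
  loopless := ⟨fun _ h => h.2.ne rfl⟩

/-- The vertices of the copies of `X` and of `Y` as vertices of `glue q X Y`. -/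
def glueMap (q : ℕ) {V : Type*} : (Fin q × V) ⊕ V → Fin (q + 1) × V
  | .inl a => (a.1.castSucc, a.2)
  | .inr y => (Fin.last q, y)

theorem glueMap_bijective (q : ℕ) {V : Type*} : Function.Bijective (glueMap q (V := V)) := by
  constructor
  · rintro (⟨c, v⟩ | y) (⟨d, w⟩ | z) h
    · simpa [glueMap] using h
    · simp [glueMap, Fin.castSucc_ne_last] at h
    · simp [glueMap, (Fin.castSucc_ne_last _).symm] at h
    · simpa [glueMap] using h
  · rintro ⟨c, v⟩
    induction c using Fin.lastCases with
    | last => exact ⟨.inr v, rfl⟩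
    | cast c => exact ⟨.inl (c, v), rfl⟩

/-- `glue` is the disjoint union of the copies of `X` and `Y`. -/
noncomputable def glueIso (q : ℕ) {V : Type*} (X Y : SimpleGraph V) :
    (graphCopies q X ⊕g Y) ≃g glue q X Y where
  toEquiv := Equiv.ofBijective (glueMap q) (glueMap_bijective q)
  map_rel_iff' := by
    rintro (⟨c, v⟩ | y) (⟨d, w⟩ | z)
    · simp [glue, glueMap, graphCopies, Fin.castSucc_ne_last]
    · simp [glue, glueMap, Fin.castSucc_ne_last]
    · simp [glue, glueMap, (Fin.castSucc_ne_last _).symm]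
    · simp [glue, glueMap]

/-- The cyclic group acts on the copies of a graph by cyclic shifts. -/
theorem representable_glue_self (q : ℕ) (hq : 1 ≤ q) {V : Type*} [Nonempty V]
    (X : SimpleGraph V) : Representable (Multiplicative (ZMod (q + 1))) (glue q X X) := by
  let shift : Multiplicative (ZMod (q + 1)) → (glue q X X ≃g glue q X X) := fun g =>
    { toEquiv := Equiv.prodCongr (Equiv.addLeft (show Fin (q + 1) from g.toAdd)) (Equiv.refl V)
      map_rel_iff' := by
        intro a b
        simp [glue] }
  refine ⟨⟨⟨shift, ?_⟩, ?_⟩, Multiplicative.ofAdd 1, ?_⟩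
  · ext a
    · exact congrArg Fin.val (zero_add (M := Fin (q + 1)) a.1)
    · rfl
  · intro g h
    ext a
    · exact congrArg Fin.val (add_assoc (G := Fin (q + 1)) g.toAdd h.toAdd a.1)
    · rfl
  · intro h
    obtain ⟨v⟩ := ‹Nonempty V›
    have h1 := congrArg (fun τ : glue q X X ≃g glue q X X => (τ ((0 : Fin (q + 1)), v)).1) h
    have h2 : (1 : Fin (q + 1)) + 0 = 0 := h1
    obtain ⟨r, rfl⟩ : ∃ r, q = r + 1 := ⟨q - 1, by omega⟩
    simp at h2

/-! ### The criterion for connected graphs -/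

/-- Induction along a walk. Taken with component labels for `f`, it keeps the image of a connected
graph inside one component. -/
theorem SimpleGraph.Connected.eq_of_forall_adj {V β : Type*} {X : SimpleGraph V}
    (hX : X.Connected) {f : V → β} (hf : ∀ u v, X.Adj u v → f u = f v) (u v : V) : f u = f v := by
  obtain ⟨p⟩ := hX.preconnected u v
  induction p with
  | nil => rfl
  | cons h _ ih => exact (hf _ _ h).trans ih

theorem nonempty_iso_of_representable {V W : Type*} [Fintype V] [Fintype W] {X : SimpleGraph V}
    {Y : SimpleGraph W} {n p : ℕ} (hX : X.Connected) (hY : Y.Connected)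
    (hV : Fintype.card V = n) (hW : Fintype.card W = n) (hp : p.Prime) (hnp : n < p)
    (h : Representable (Multiplicative (ZMod p)) (graphCopies (p - 1) X ⊕g Y)) :
    Nonempty (X ≃g Y) := by
  classical
  set Z := graphCopies (p - 1) X ⊕g Y with hZ
  obtain ⟨ρ, g, hg⟩ := h
  obtain ⟨v₀⟩ := hX.nonempty
  obtain ⟨y₀⟩ := hY.nonempty
  have hpow : (ρ g) ^ p = 1 := by
    rw [← map_pow]
    have : g ^ p = 1 := by
      apply Multiplicative.toAdd.injective
      simp
    rw [this, map_one]
  have hiter : (⇑(ρ g))^[p] = id := by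
    have : ∀ (k : ℕ) (x), (⇑(ρ g))^[k] x = ((ρ g) ^ k) x := by
      intro k
      induction k with
      | zero => intro x; rfl
      | succ k ih => intro x; rw [Function.iterate_succ_apply, ih, pow_succ]; rfl
    funext x
    rw [this, hpow]
    rfl
  set σ : Z ≃g Z := ρ g with hσ
  have hadj : ∀ a b, Z.Adj (σ a) (σ b) ↔ Z.Adj a b := fun a b => σ.map_rel_iff
  -- the index of the component of a vertex
  let lab : (Fin (p - 1) × V) ⊕ W → Option (Fin (p - 1)) :=
    Sum.elim (fun a => some a.1) (fun _ => none)
  have hlab : ∀ a b, Z.Adj a b → lab a = lab b := by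
    rintro (⟨c, v⟩ | y) (⟨d, w⟩ | z) hab
    · simp only [hZ, SimpleGraph.sum_adj_inl] at hab
      exact congrArg some hab.1
    · simp [hZ] at hab
    · simp [hZ] at hab
    · rfl
  have hlabY : ∀ y z, lab (σ (.inr y)) = lab (σ (.inr z)) := fun y z =>
    hY.eq_of_forall_adj (f := fun y => lab (σ (.inr y)))
      (fun u v huv => hlab _ _ ((hadj _ _).2 (by simpa [hZ] using huv))) y z
  have hlabX : ∀ c v w, lab (σ (.inl (c, v))) = lab (σ (.inl (c, w))) := fun c v w =>
    hX.eq_of_forall_adj (f := fun v => lab (σ (.inl (c, v))))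
      (fun u v huv => hlab _ _ ((hadj _ _).2 (by simpa [hZ, graphCopies] using huv))) v w
  rcases hy₀ : σ (.inr y₀) with ⟨c, v⟩ | z
  · -- the copy of `Y` is moved onto a copy of `X`
    have hmove : ∀ y, ∃ v, σ (.inr y) = .inl (c, v) := by
      intro y
      have := hlabY y y₀
      rw [hy₀] at this
      rcases h : σ (.inr y) with ⟨d, w⟩ | z
      · rw [h] at this
        simp only [lab, Sum.elim_inl, Option.some.injEq] at this
        exact ⟨w, by rw [this]⟩
      · rw [h] at this
        simp [lab] at this
    choose ψ hψ using hmove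
    have hinj : Function.Injective ψ := by
      intro y z hyz
      have : σ (.inr y) = σ (.inr z) := by rw [hψ, hψ, hyz]
      simpa using this
    -- `ψ` embeds `Y` into one copy of `X`; equality of the numbers of vertices makes it onto.
    have hbij : Function.Bijective ψ :=
      (Fintype.bijective_iff_injective_and_card ψ).2 ⟨hinj, by rw [hV, hW]⟩
    refine ⟨(SimpleGraph.Iso.symm ⟨Equiv.ofBijective ψ hbij, ?_⟩)⟩
    intro y z
    have := hadj (.inr y) (.inr z)
    rw [hψ, hψ] at this
    simpa [hZ, graphCopies] using this
  · -- otherwise the automorphism is trivial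
    exfalso
    apply hg
    have hYY : ∀ y, ∃ z, σ (.inr y) = .inr z := by
      intro y
      have := hlabY y y₀
      rw [hy₀] at this
      rcases h : σ (.inr y) with ⟨d, w⟩ | z
      · rw [h] at this
        simp [lab] at this
      · exact ⟨z, rfl⟩
    choose ψ hψ using hYY
    have hψid : ψ = id := by
      apply Function.eq_id_of_iterate_prime hp (by omega)
      -- The inclusion of the component intertwines `ψ` with `σ`, so the identity for the `p`-th
      -- iterate descends to `ψ`. The same device is used below for the copies of `X`.
      have hsemi : Function.Semiconj Sum.inr ψ σ := fun y => (hψ y).symm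
      funext y
      apply Sum.inr_injective (α := Fin (p - 1) × V)
      rw [(hsemi.iterate_right p).eq y, hiter]
      rfl
    -- `Y` is already fixed pointwise, so by injectivity no vertex outside can be sent into it.
    have hXX : ∀ c v, ∃ d, ∃ w, σ (.inl (c, v)) = .inl (d, w) := by
      intro c v
      rcases h : σ (.inl (c, v)) with ⟨d, w⟩ | z
      · exact ⟨d, w, rfl⟩
      · have h2 : σ (.inr z) = .inr z := by rw [hψ, hψid]; rfl
        rw [← h2] at h
        simp at h
    choose τ χ hτ using hXX
    have hτc : ∀ c v w, τ c v = τ c w := by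
      intro c v w
      have := hlabX c v w
      rw [hτ, hτ] at this
      simpa [lab] using this
    -- The induced map on the set of copies: there are only `p - 1` of them, one short of an orbit
    -- of length `p`. By `hτc` the choice of `v₀` is immaterial.
    have hτid : (fun c => τ c v₀) = id := by
      apply Function.eq_id_of_iterate_prime hp (by simpa using hp.pos)
      have hsemi : Function.Semiconj (fun a : Fin (p - 1) × V => a.1)
          (fun a => (τ a.1 a.2, χ a.1 a.2)) (fun c => τ c v₀) := fun a => hτc a.1 a.2 v₀
      have hsemi' : Function.Semiconj (Sum.inl : _ → (Fin (p - 1) × V) ⊕ W)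
          (fun a => (τ a.1 a.2, χ a.1 a.2)) σ := fun a => (hτ a.1 a.2).symm
      funext c
      have h1 := (hsemi.iterate_right p).eq (c, v₀)
      have h2 := (hsemi'.iterate_right p).eq (c, v₀)
      rw [hiter] at h2
      rw [← h1, Sum.inl_injective h2]
      rfl
    have hfix : ∀ c v, σ (.inl (c, v)) = .inl (c, χ c v) := by
      intro c v
      rw [hτ, hτc c v v₀]
      have := congrFun hτid c
      simp only [id] at this
      rw [this]
    have hχid : ∀ c, χ c = id := by
      intro c
      apply Function.eq_id_of_iterate_prime hp (by omega)
      have hsemi : Function.Semiconj (fun v => (Sum.inl (c, v) : (Fin (p - 1) × V) ⊕ W))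
          (χ c) σ := fun v => (hfix c v).symm
      funext v
      have := (hsemi.iterate_right p).eq v
      rw [hiter] at this
      simpa using this
    apply RelIso.ext
    rintro (⟨c, v⟩ | y)
    · rw [hfix, hχid]; rfl
    · rw [hψ, hψid]; rfl

theorem representable_copies_iff {V W : Type*} [Fintype V] [Fintype W] {X : SimpleGraph V}
    {Y : SimpleGraph W} {n p : ℕ} (hX : X.Connected) (hY : Y.Connected)
    (hV : Fintype.card V = n) (hW : Fintype.card W = n) (hp : p.Prime) (hnp : n < p) :
    Representable (Multiplicative (ZMod p)) (graphCopies (p - 1) X ⊕g Y) ↔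
      Nonempty (X ≃g Y) := by
  refine ⟨nonempty_iso_of_representable hX hY hV hW hp hnp, ?_⟩
  rintro ⟨φ⟩
  obtain ⟨q, rfl⟩ : ∃ q, p = q + 1 := ⟨p - 1, by have := hp.pos; omega⟩
  have hq : 1 ≤ q := by have := hp.two_le; omega
  have := hX.nonempty
  exact (representable_glue_self q hq X).of_iso
    ((glueIso q X X).symm.trans (SimpleGraph.Iso.sumCongr SimpleGraph.Iso.refl φ))

/-! ### Cones -/

/-- The cone over a graph on `{0, …, n-1}`, with apex `n`. -/
def cone {n : ℕ} (X : SimpleGraph (Fin n)) : SimpleGraph (Fin (n + 1)) where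
  Adj i j := i ≠ j ∧ (i = Fin.last n ∨ j = Fin.last n ∨
    ∃ a b, i = Fin.castSucc a ∧ j = Fin.castSucc b ∧ X.Adj a b)
  symm := ⟨by
    rintro i j ⟨hij, h | h | ⟨a, b, ha, hb, h⟩⟩
    · exact ⟨hij.symm, .inr (.inl h)⟩
    · exact ⟨hij.symm, .inl h⟩
    · exact ⟨hij.symm, .inr (.inr ⟨b, a, hb, ha, h.symm⟩)⟩⟩
  loopless := ⟨fun _ h => h.1 rfl⟩

theorem cone_adj_castSucc {n : ℕ} {X : SimpleGraph (Fin n)} {a b : Fin n} :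
    (cone X).Adj a.castSucc b.castSucc ↔ X.Adj a b := by
  constructor
  · rintro ⟨_, h | h | ⟨c, d, hc, hd, h⟩⟩
    · exact absurd h (Fin.castSucc_ne_last _)
    · exact absurd h (Fin.castSucc_ne_last _)
    · rwa [Fin.castSucc_injective _ hc, Fin.castSucc_injective _ hd]
  · intro h
    exact ⟨fun e => h.ne (Fin.castSucc_injective _ e), .inr (.inr ⟨a, b, rfl, rfl, h⟩)⟩

theorem cone_adj_last {n : ℕ} {X : SimpleGraph (Fin n)} {i : Fin (n + 1)} :
    (cone X).Adj (Fin.last n) i ↔ i ≠ Fin.last n :=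
  ⟨fun h => h.1.symm, fun h => ⟨h.symm, .inl rfl⟩⟩

theorem connected_cone {n : ℕ} (X : SimpleGraph (Fin n)) : (cone X).Connected := by
  have h : ∀ i, (cone X).Reachable (Fin.last n) i := by
    intro i
    by_cases hi : i = Fin.last n
    · rw [hi]
    · exact (cone_adj_last.2 hi).reachable
  exact ⟨fun i j => (h i).symm.trans (h j)⟩

/-- Two vertices adjacent to all others can be exchanged. -/
theorem SimpleGraph.exists_iso_swap {V : Type*} {X : SimpleGraph V} {a b : V}
    (ha : ∀ v, v ≠ a → X.Adj a v) (hb : ∀ v, v ≠ b → X.Adj b v) : ∃ φ : X ≃g X, φ a = b := by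
  classical
  refine ⟨⟨Equiv.swap a b, ?_⟩, Equiv.swap_apply_left a b⟩
  intro u v
  by_cases huv : u = v
  · subst huv; simp
  have key : ∀ u v, u ≠ v → (u = a ∨ u = b ∨ v = a ∨ v = b) → X.Adj u v := by
    rintro u v h (rfl | rfl | rfl | rfl)
    · exact ha _ h.symm
    · exact hb _ h.symm
    · exact (ha _ h).symm
    · exact (hb _ h).symm
  -- The exchange preserves the property of meeting `{a, b}`. Pairs of distinct vertices with it are
  -- always adjacent, and the other pairs are not moved.
  by_cases h : u = a ∨ u = b ∨ v = a ∨ v = b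
  · refine iff_of_true (key _ _ (fun e => huv (by simpa using e)) ?_) (key _ _ huv h)
    rcases h with rfl | rfl | rfl | rfl <;> simp
  · push Not at h
    rw [Equiv.swap_apply_of_ne_of_ne h.1 h.2.1, Equiv.swap_apply_of_ne_of_ne h.2.2.1 h.2.2.2]

/-- An isomorphism of cones may move the apex, but the image of the apex and the apex of the target
are both adjacent to all other vertices. Exchanging them yields an isomorphism that respects the
apices and so restricts to the bases. -/
theorem nonempty_cone_iso_iff {n : ℕ} {X Y : SimpleGraph (Fin n)} :
    Nonempty (cone X ≃g cone Y) ↔ Nonempty (X ≃g Y) := by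
  constructor
  · rintro ⟨φ⟩
    obtain ⟨ψ, hψ⟩ := SimpleGraph.exists_iso_swap (X := cone Y) (a := φ (Fin.last n))
      (b := Fin.last n) (fun v hv => by
        have : φ.symm v ≠ Fin.last n := fun h => hv (by rw [← h]; simp)
        have h2 := φ.map_rel_iff.2 (cone_adj_last (X := X).2 this)
        simpa using h2) (fun v hv => cone_adj_last.2 hv)
    let θ : cone X ≃g cone Y := φ.trans ψ
    have hθ : θ (Fin.last n) = Fin.last n := hψ
    have hcast : ∀ a : Fin n, ∃ b : Fin n, θ a.castSucc = b.castSucc := by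
      intro a
      obtain h | ⟨b, h⟩ := (θ a.castSucc).eq_castSucc_or_eq_last.symm
      · rw [← hθ] at h
        exact absurd (θ.injective h) (Fin.castSucc_ne_last _)
      · exact ⟨b, h⟩
    choose f hf using hcast
    have hinj : Function.Injective f := by
      intro a b hab
      have : θ a.castSucc = θ b.castSucc := by rw [hf, hf, hab]
      exact Fin.castSucc_injective _ (θ.injective this)
    refine ⟨⟨Equiv.ofBijective f (Finite.injective_iff_bijective.1 hinj), ?_⟩⟩
    intro a b
    have : (cone Y).Adj _ _ ↔ (cone X).Adj a.castSucc b.castSucc := θ.map_rel_iff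
    change (cone Y).Adj (θ a.castSucc) (θ b.castSucc) ↔ _ at this
    rw [hf, hf, cone_adj_castSucc, cone_adj_castSucc] at this
    exact this
  · rintro ⟨φ⟩
    let f : Fin (n + 1) → Fin (n + 1) := Fin.lastCases (Fin.last n) (fun a => (φ a).castSucc)
    have hl : f (Fin.last n) = Fin.last n := by simp [f]
    have hc : ∀ a, f (Fin.castSucc a) = (φ a).castSucc := by intro a; simp [f]
    have hinj : Function.Injective f := by
      intro i j hij
      induction i using Fin.lastCases with
      | last =>
        induction j using Fin.lastCases with
        | last => rfl
        | cast b => rw [hl, hc] at hij; exact absurd hij.symm (Fin.castSucc_ne_last _)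
      | cast a =>
        induction j using Fin.lastCases with
        | last => rw [hl, hc] at hij; exact absurd hij (Fin.castSucc_ne_last _)
        | cast b =>
          rw [hc, hc] at hij
          rw [φ.injective (Fin.castSucc_injective _ hij)]
    refine ⟨⟨Equiv.ofBijective f (Finite.injective_iff_bijective.1 hinj), ?_⟩⟩
    intro i j
    change (cone Y).Adj (f i) (f j) ↔ _
    induction i using Fin.lastCases with
    | last =>
      rw [hl, cone_adj_last, cone_adj_last, ← hinj.ne_iff (x := j) (y := Fin.last n), hl]
    | cast a =>
      induction j using Fin.lastCases with
      | last =>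
        rw [SimpleGraph.adj_comm, hl, cone_adj_last, SimpleGraph.adj_comm, cone_adj_last,
          ← hinj.ne_iff (x := a.castSucc) (y := Fin.last n), hl]
      | cast b =>
        rw [hc, hc, cone_adj_castSucc, cone_adj_castSucc]
        exact φ.map_rel_iff

/-! ### Program fragments

A fragment is a transducer with an exit in place of halting, so that fragments can be composed. The
work tapes will hold binary counters: a symbol consists of a flag, which marks cell `0`, and
possibly a digit. -/

/-- The work tape symbols: a flag for cell `0`, and a binary digit or nothing. -/
abbrev CounterSym : Type := Bool × Option Bool

/-- Change the type of states of an action. -/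
def TransducerAction.mapNext {S S' Γ : Type} {K : ℕ} (f : S → S') (a : TransducerAction S Γ K) :
    TransducerAction S' Γ K where
  next := f a.next
  inputMove := a.inputMove
  write := a.write
  workMove := a.workMove
  emit := a.emit

/-- A fragment of a transducer with `K` work tapes; `none` as the next state is the exit. -/
structure Frag (K : ℕ) where
  State : Type
  finite_state : Finite State
  start : State
  trans : State → InputCell → (Fin K → CounterSym) → TransducerAction (Option State) CounterSym K

/-- A configuration without the state. -/
@[ext]
structure Store (K : ℕ) where
  inputPos : ℕ
  work : Fin K → ℕ → CounterSym
  head : Fin K → ℕ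
  out : List Bool

namespace Store

variable {K : ℕ}

/-- The scanned symbols. -/
def cells (d : Store K) : Fin K → CounterSym := fun t => d.work t (d.head t)

/-- The effect of an action. -/
def act {S : Type} (w : List Bool) (d : Store K) (a : TransducerAction S CounterSym K) :
    Store K where
  inputPos := min (a.inputMove.apply d.inputPos) (w.length + 1)
  work := fun t => Function.update (d.work t) (d.head t) (a.write t)
  head := fun t => (a.workMove t).apply (d.head t)
  out := d.out ++ a.emit.toList

end Store

/-- The action that does nothing but change the state. -/
def idleAction {S : Type} {K : ℕ} (s : Fin K → CounterSym) (q : S) :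
    TransducerAction S CounterSym K where
  next := q
  inputMove := .stay
  write := s
  workMove := fun _ => .stay
  emit := none

/-- The bound on the head position is needed because every action clips the position to the right
end marker. -/
theorem Store.act_idle {K : ℕ} {S : Type} {w : List Bool} {d : Store K}
    (hd : d.inputPos ≤ w.length + 1) (q : S) : d.act w (idleAction d.cells q) = d := by
  apply Store.ext
  · simp [Store.act, idleAction, HeadMove.apply, hd]
  · funext t
    exact Function.update_eq_self _ _
  · rfl
  · exact List.append_nil _

namespace Frag

variable {K : ℕ}

/-- `F.Steps w s q d d'`: started in state `q` with store `d`, the fragment exits with store `d'`,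
and all heads stay on the first `s` cells. -/
inductive Steps (F : Frag K) (w : List Bool) (s : ℕ) : Option F.State → Store K → Store K → Prop
  | exit (d : Store K) : (∀ t, d.head t < s) → Steps F w s none d d
  | step (q : F.State) (d d' : Store K) : (∀ t, d.head t < s) →
      Steps F w s (F.trans q (inputCell w d.inputPos) d.cells).next
        (d.act w (F.trans q (inputCell w d.inputPos) d.cells)) d' →
      Steps F w s (some q) d d'

/-- Started with store `d` the fragment exits with store `d'`. -/
def Run (F : Frag K) (w : List Bool) (s : ℕ) (d d' : Store K) : Prop :=
  F.Steps w s (some F.start) d d'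

/-- A single action. -/
def single (inputMove : HeadMove) (write : (Fin K → CounterSym) → Fin K → CounterSym)
    (workMove : Fin K → HeadMove) (emit : Option Bool) : Frag K where
  State := Unit
  finite_state := inferInstance
  start := ()
  trans := fun _ _ s => ⟨none, inputMove, write s, workMove, emit⟩

/-- Sequential composition. -/
def seq (F G : Frag K) : Frag K where
  State := F.State ⊕ G.State
  finite_state := by
    have := F.finite_state
    have := G.finite_state
    infer_instance
  start := .inl F.start
  trans
    | .inl q, c, s => (F.trans q c s).mapNext fun o => some (o.elim (.inr G.start) .inl)
    | .inr q, c, s => (G.trans q c s).mapNext (Option.map .inr)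

/-- Branching. -/
def branch (test : InputCell → (Fin K → CounterSym) → Bool) (F G : Frag K) : Frag K where
  State := Option (F.State ⊕ G.State)
  finite_state := by
    have := F.finite_state
    have := G.finite_state
    infer_instance
  start := none
  trans
    | none, c, s => idleAction s (some (some (if test c s then .inl F.start else .inr G.start)))
    | some (.inl q), c, s => (F.trans q c s).mapNext (Option.map fun q => some (.inl q))
    | some (.inr q), c, s => (G.trans q c s).mapNext (Option.map fun q => some (.inr q))

/-- Iteration. -/
def loop (test : InputCell → (Fin K → CounterSym) → Bool) (F : Frag K) : Frag K where
  State := Option F.State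
  finite_state := by
    have := F.finite_state
    infer_instance
  start := none
  trans
    | none, c, s => idleAction s (if test c s then some (some F.start) else none)
    | some q, c, s => (F.trans q c s).mapNext some

theorem Steps.head_lt {F : Frag K} {w : List Bool} {s : ℕ} {q : Option F.State} {d d' : Store K}
    (h : F.Steps w s q d d') : ∀ t, d.head t < s := by
  cases h with
  | exit _ h => exact h
  | step _ _ _ h => exact h

variable {F G : Frag K} {w : List Bool} {s : ℕ} {d d' d'' : Store K}
  {test : InputCell → (Fin K → CounterSym) → Bool}

theorem run_single {im : HeadMove} {wr : (Fin K → CounterSym) → Fin K → CounterSym}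
    {wm : Fin K → HeadMove} {em : Option Bool} (hd : ∀ t, d.head t < s)
    (hact : d.act w (⟨(), im, wr d.cells, wm, em⟩ : TransducerAction Unit CounterSym K) = d')
    (hd' : ∀ t, d'.head t < s) : (single im wr wm em).Run w s d d' := by
  refine Steps.step _ _ _ hd ?_
  change Steps _ w s none (d.act w (⟨(), im, wr d.cells, wm, em⟩ :
    TransducerAction Unit CounterSym K)) d'
  rw [hact]
  exact Steps.exit _ hd'

theorem Steps.seq_right {q : Option G.State} (h : G.Steps w s q d d') :
    (F.seq G).Steps w s (q.map .inr) d d' := by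
  induction h with
  | exit d hd => exact Steps.exit d hd
  | step q d d' hd _ ih => exact Steps.step (F := F.seq G) (.inr q) d d' hd ih

/-- Exits of `F` are redirected to the start of `G` by the transition itself; when the run of `F` is
used up, that of `G` continues with the same store. -/
theorem Steps.seq_left {q : Option F.State} (h : F.Steps w s q d d') (h' : G.Run w s d' d'') :
    (F.seq G).Steps w s (some (q.elim (.inr G.start) .inl)) d d'' := by
  induction h with
  | exit d hd => exact h'.seq_right
  | step q d d' hd _ ih => exact Steps.step (F := F.seq G) (.inl q) d d'' hd (ih h')

theorem Run.seq (h : F.Run w s d d') (h' : G.Run w s d' d'') : (F.seq G).Run w s d d'' :=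
  Steps.seq_left h h'

theorem Steps.branch_left {q : Option F.State} (h : F.Steps w s q d d') :
    (branch test F G).Steps w s (q.map fun q => some (.inl q)) d d' := by
  induction h with
  | exit d hd => exact Steps.exit d hd
  | step q d d' hd _ ih => exact Steps.step (F := branch test F G) (some (.inl q)) d d' hd ih

theorem Steps.branch_right {q : Option G.State} (h : G.Steps w s q d d') :
    (branch test F G).Steps w s (q.map fun q => some (.inr q)) d d' := by
  induction h with
  | exit d hd => exact Steps.exit d hd
  | step q d d' hd _ ih => exact Steps.step (F := branch test F G) (some (.inr q)) d d' hd ih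

/-- Branches and loops make their tests in a state of their own that leaves the store alone. The
space bound for this extra step is that of the first configuration of the remaining run. -/
theorem Steps.of_idle {q : F.State} {o : Option F.State} (hpos : d.inputPos ≤ w.length + 1)
    (hq : F.trans q (inputCell w d.inputPos) d.cells = idleAction d.cells o)
    (h : F.Steps w s o d d') : F.Steps w s (some q) d d' := by
  refine Steps.step _ _ _ h.head_lt ?_
  rw [hq, Store.act_idle hpos]
  exact h

theorem Run.branch_true (hpos : d.inputPos ≤ w.length + 1)
    (ht : test (inputCell w d.inputPos) d.cells = true) (h : F.Run w s d d') :
    (branch test F G).Run w s d d' :=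
  Steps.of_idle hpos (congrArg (fun b : Bool =>
    idleAction d.cells (some (some (if b then Sum.inl F.start else Sum.inr G.start)))) ht)
    (Steps.branch_left h)

theorem Run.branch_false (hpos : d.inputPos ≤ w.length + 1)
    (ht : test (inputCell w d.inputPos) d.cells = false) (h : G.Run w s d d') :
    (branch test F G).Run w s d d' :=
  Steps.of_idle hpos (congrArg (fun b : Bool =>
    idleAction d.cells (some (some (if b then Sum.inl F.start else Sum.inr G.start)))) ht)
    (Steps.branch_right h)

theorem Run.loop_exit (hpos : d.inputPos ≤ w.length + 1)
    (ht : test (inputCell w d.inputPos) d.cells = false) (hd : ∀ t, d.head t < s) :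
    (loop test F).Run w s d d :=
  Steps.of_idle hpos (congrArg (fun b : Bool =>
    idleAction d.cells (if b then some (some F.start) else none)) ht) (Steps.exit d hd)

theorem Steps.loop_body {q : Option F.State} (h : F.Steps w s q d d')
    (h' : (loop test F).Run w s d' d'') : (loop test F).Steps w s (some q) d d'' := by
  induction h with
  | exit d hd => exact h'
  | step q d d' hd _ ih => exact Steps.step (F := loop test F) (some q) d d'' hd (ih h')

theorem Run.loop_step (hpos : d.inputPos ≤ w.length + 1)
    (ht : test (inputCell w d.inputPos) d.cells = true) (h : F.Run w s d d')
    (h' : (loop test F).Run w s d' d'') : (loop test F).Run w s d d'' :=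
  Steps.of_idle hpos (congrArg (fun b : Bool =>
    idleAction d.cells (if b then some (some F.start) else none)) ht) (Steps.loop_body h h')

/-! ### From fragments to transducers -/

/-- The transducer that runs a fragment and halts. -/
def toTransducer (F : Frag K) : Transducer where
  State := Option F.State
  finite_state := by
    have := F.finite_state
    infer_instance
  Sym := CounterSym
  finite_sym := inferInstance
  blank := (false, none)
  tapes := K
  start := some F.start
  trans
    | none, _, _ => none
    | some q, c, s => some (F.trans q c s)

/-- The configuration with a given state and store. -/
def toCfg (F : Frag K) (q : Option F.State) (d : Store K) : F.toTransducer.Cfg where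
  state := q
  inputPos := d.inputPos
  work := d.work
  head := d.head
  out := d.out

/-- Blank tapes. -/
def blankStore (K : ℕ) : Store K where
  inputPos := 0
  work := fun _ _ => (false, none)
  head := fun _ => 0
  out := []

theorem step_toCfg_some (F : Frag K) (w : List Bool) (q : F.State) (d : Store K) :
    F.toTransducer.step w (F.toCfg (some q) d) =
      some (F.toCfg (F.trans q (inputCell w d.inputPos) d.cells).next
        (d.act w (F.trans q (inputCell w d.inputPos) d.cells))) := rfl

theorem step_toCfg_none (F : Frag K) (w : List Bool) (d : Store K) :
    F.toTransducer.step w (F.toCfg none d) = none := rfl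

theorem Steps.reaches {q : Option F.State} (h : F.Steps w s q d d') :
    StateTransition.Reaches (F.toTransducer.step w) (F.toCfg q d) (F.toCfg none d') := by
  induction h with
  | exit d hd => exact Relation.ReflTransGen.refl
  | step q d d' hd _ ih => exact Relation.ReflTransGen.head (step_toCfg_some F w q d) ih

/-- The machine is deterministic: every reachable configuration lies on the one run that `Steps`
records, and there the bound is checked at each step. -/
theorem Steps.usesSpace {q : Option F.State} (h : F.Steps w s q d d')
    {c : F.toTransducer.Cfg}
    (hc : StateTransition.Reaches (F.toTransducer.step w) (F.toCfg q d) c) :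
    ∀ t, c.head t < s := by
  induction h with
  | exit d hd =>
    rcases Relation.ReflTransGen.cases_head hc with rfl | ⟨b, hb, -⟩
    · exact hd
    · rw [step_toCfg_none] at hb
      simp at hb
  | step q d d' hd _ ih =>
    rcases Relation.ReflTransGen.cases_head hc with rfl | ⟨b, hb, hbc⟩
    · exact hd
    · rw [step_toCfg_some] at hb
      obtain rfl := Option.some.inj hb
      exact ih hbc

theorem Run.outputs (h : F.Run w s (blankStore K) d') : F.toTransducer.Outputs w d'.out :=
  ⟨F.toCfg none d', h.reaches, step_toCfg_none F w d', rfl⟩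

theorem Run.usesSpace (h : F.Run w s (blankStore K) d') : F.toTransducer.UsesSpace w s :=
  fun _ hc => Steps.usesSpace h hc

end Frag

/-! ### Binary counters -/

/-- The value of a list of binary digits, least significant digit first. -/
def digitsVal : List Bool → ℕ
  | [] => 0
  | b :: l => b.toNat + 2 * digitsVal l

/-- The successor on lists of binary digits. -/
def digitsSucc : List Bool → List Bool
  | [] => [true]
  | false :: l => true :: l
  | true :: l => false :: digitsSucc l

theorem digitsVal_succ (l : List Bool) : digitsVal (digitsSucc l) = digitsVal l + 1 := by
  induction l with
  | nil => rfl
  | cons b l ih =>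
    cases b
    · simp [digitsSucc, digitsVal]; omega
    · simp [digitsSucc, digitsVal, ih]; omega

/-- A digit is added only when the carry passes through all digits. They are then all ones, and the
new value is `2 ^ l.length`. So the length is controlled by the value, however often the counter is
increased. -/
theorem length_digitsSucc_le {l : List Bool} {L : ℕ} (hl : l.length ≤ L)
    (hv : digitsVal l + 1 < 2 ^ L) : (digitsSucc l).length ≤ L := by
  induction l generalizing L with
  | nil =>
    rcases L with _ | L
    · simp [digitsVal] at hv
    · simp [digitsSucc]
  | cons b l ih =>
    cases b
    · simpa [digitsSucc] using hl
    · rcases L with _ | L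
      · simp at hl
      · have := ih (L := L) (by simpa using hl) (by simp [digitsVal, pow_succ] at hv; omega)
        simpa [digitsSucc] using this

theorem digitsVal_replicate (k : ℕ) : digitsVal (List.replicate k false) = 0 := by
  induction k with
  | zero => rfl
  | succ k ih => simp [List.replicate_succ, digitsVal, ih]

/-- Missing digits count as `0`, so the recursion continues past the end. This permits comparing
lists of different lengths, with leading zeros. -/
theorem digitsVal_drop (l : List Bool) (i : ℕ) :
    digitsVal (l.drop i) = (l[i]?.getD false).toNat + 2 * digitsVal (l.drop (i + 1)) := by
  by_cases h : i < l.length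
  · rw [List.drop_eq_getElem_cons h]
    simp [digitsVal, h]
  · rw [List.drop_eq_nil_of_le (by omega), List.drop_eq_nil_of_le (by omega),
      List.getElem?_eq_none (by omega)]
    rfl

/-- Cell `i` of a work tape that holds a list of digits. -/
def counterCell (l : List Bool) (i : ℕ) : CounterSym := (i == 0, l[i]?)

/-- `suf.tail` covers two cases at once: overwriting a digit, and appending one when `suf` is empty.
-/
theorem counterCell_write (pre suf : List Bool) (b : Bool) :
    Function.update (counterCell (pre ++ suf)) pre.length
      ((counterCell (pre ++ suf) pre.length).1, some b) =
      counterCell (pre ++ b :: suf.tail) := by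
  funext i
  by_cases hi : i = pre.length
  · subst hi
    simp [counterCell]
  · rw [Function.update_of_ne hi]
    simp only [counterCell, Prod.mk.injEq, true_and]
    rcases lt_or_gt_of_ne hi with h | h
    · rw [List.getElem?_append_left h, List.getElem?_append_left h]
    · rw [List.getElem?_append_right h.le, List.getElem?_append_right h.le]
      obtain ⟨j, hj⟩ : ∃ j, i - pre.length = j + 1 := ⟨i - pre.length - 1, by omega⟩
      rw [hj, List.getElem?_cons_succ]
      cases suf <;> simp

/-- The store whose work tapes hold lists of digits. -/
def counterStore {K : ℕ} (pos : ℕ) (ds : Fin K → List Bool) (hd : Fin K → ℕ) (out : List Bool) :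
    Store K where
  inputPos := pos
  work := fun t => counterCell (ds t)
  head := hd
  out := out

namespace Frag

variable {K : ℕ} {w : List Bool} {s : ℕ} {pos : ℕ} {ds : Fin K → List Bool} {hd : Fin K → ℕ}
  {out : List Bool}

/-- Move the head of tape `r`. -/
def moveOp (r : Fin K) (m : HeadMove) : Frag K :=
  single .stay id (Function.update (fun _ => .stay) r m) none

/-- Write a digit on tape `r` and move the head. -/
def writeOp (r : Fin K) (b : Bool) (m : HeadMove) : Frag K :=
  single .stay (fun s => Function.update s r ((s r).1, some b))
    (Function.update (fun _ => .stay) r m) none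

/-- Return the head of tape `r` to cell `0`. -/
def home (r : Fin K) : Frag K := loop (fun _ s => !(s r).1) (moveOp r .left)

theorem update_head_lt {s x : ℕ} (hs : ∀ t, hd t < s) (r : Fin K) (hx : x < s) :
    ∀ t, Function.update hd r x t < s := by
  intro t
  rcases eq_or_ne t r with rfl | h
  · simpa using hx
  · simpa [h] using hs t

theorem workMove_update (r : Fin K) (m : HeadMove) :
    (fun t => (Function.update (fun _ => HeadMove.stay) r m t).apply (hd t)) =
      Function.update hd r (m.apply (hd r)) := by
  funext t
  rcases eq_or_ne t r with rfl | h
  · simp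
  · simp [h, HeadMove.apply]

theorem run_moveOp (r : Fin K) (m : HeadMove) (hpos : pos ≤ w.length + 1)
    (hs : ∀ t, hd t < s) (hm : m.apply (hd r) < s) :
    (moveOp r m).Run w s (counterStore pos ds hd out)
      (counterStore pos ds (Function.update hd r (m.apply (hd r))) out) := by
  refine run_single hs ?_ (update_head_lt hs r hm)
  apply Store.ext
  · exact min_eq_left hpos
  · funext t
    exact Function.update_eq_self _ _
  · exact workMove_update r m
  · exact List.append_nil _

theorem run_writeOp (r : Fin K) (b : Bool) (m : HeadMove) {pre suf : List Bool}
    (hds : ds r = pre ++ suf) (hh : hd r = pre.length) (hpos : pos ≤ w.length + 1)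
    (hs : ∀ t, hd t < s) (hm : m.apply (hd r) < s) :
    (writeOp r b m).Run w s (counterStore pos ds hd out)
      (counterStore pos (Function.update ds r (pre ++ b :: suf.tail))
        (Function.update hd r (m.apply (hd r))) out) := by
  refine run_single hs ?_ (update_head_lt hs r hm)
  apply Store.ext
  · exact min_eq_left hpos
  · funext t
    change Function.update (counterCell (ds t)) (hd t) (Function.update
      (fun t => counterCell (ds t) (hd t)) r ((counterCell (ds r) (hd r)).1, some b) t) =
      counterCell (Function.update ds r (pre ++ b :: suf.tail) t)
    rcases eq_or_ne t r with rfl | h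
    · rw [Function.update_self, Function.update_self, hds, hh]
      exact counterCell_write pre suf b
    · rw [Function.update_of_ne h, Function.update_of_ne h]
      exact Function.update_eq_self _ _
  · exact workMove_update r m
  · exact List.append_nil _

/-- The flag in cell `0` is what stops the head; a work tape has no end marker of its own. -/
theorem run_home (r : Fin K) (hpos : pos ≤ w.length + 1) (hs : ∀ t, hd t < s) :
    (home r).Run w s (counterStore pos ds hd out)
      (counterStore pos ds (Function.update hd r 0) out) := by
  generalize hx : hd r = x
  induction x generalizing hd with
  | zero =>
    rw [← hx, Function.update_eq_self]
    exact Run.loop_exit hpos (by simp [Store.cells, counterStore, counterCell, hx]) hs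
  | succ x ih =>
    have hlt : x < s := by have := hs r; omega
    have hm : HeadMove.left.apply (hd r) = x := by simp [HeadMove.apply, hx]
    have h1 := run_moveOp (w := w) (ds := ds) (out := out) r .left hpos hs (by rwa [hm])
    rw [hm] at h1
    have h2 := ih (hd := Function.update hd r x) (update_head_lt hs r hlt) (by simp)
    rw [Function.update_idem] at h2
    exact Run.loop_step hpos (by simp [Store.cells, counterStore, counterCell, hx]) h1 h2

/-- Increase the counter on tape `r`. -/
def incTape (r : Fin K) : Frag K :=
  (loop (fun _ s => (s r).2 == some true) (writeOp r false .right)).seq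
    ((writeOp r true .stay).seq (home r))

/-- `pre` consists of the cells already passed, where the carry has turned ones into zeros. The loop
stops at the first cell without a `1`, possibly just beyond the last digit, and writing a `1` there
completes the successor. -/
theorem run_incTape_loop (r : Fin K) (hpos : pos ≤ w.length + 1) (pre suf : List Bool)
    (hds : ds r = pre ++ suf) (hh : hd r = pre.length) (hs : ∀ t, hd t < s)
    (hlen : (pre ++ digitsSucc suf).length < s) :
    ∃ pre' suf', pre' ++ true :: suf'.tail = pre ++ digitsSucc suf ∧
      (loop (fun _ s => (s r).2 == some true) (writeOp r false .right)).Run w s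
        (counterStore pos ds hd out) (counterStore pos (Function.update ds r (pre' ++ suf'))
          (Function.update hd r pre'.length) out) := by
  induction suf generalizing pre ds hd with
  | nil =>
    refine ⟨pre, [], rfl, ?_⟩
    rw [← hds, ← hh, Function.update_eq_self, Function.update_eq_self]
    exact Run.loop_exit hpos (by simp [Store.cells, counterStore, counterCell, hds, hh]) hs
  | cons b suf ih =>
    cases b
    · refine ⟨pre, false :: suf, rfl, ?_⟩
      rw [← hds, ← hh, Function.update_eq_self, Function.update_eq_self]
      exact Run.loop_exit hpos (by simp [Store.cells, counterStore, counterCell, hds, hh]) hs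
    · have hlt : HeadMove.right.apply (hd r) < s := by
        simp [digitsSucc] at hlen
        simp [HeadMove.apply, hh]
        omega
      have h1 := run_writeOp (w := w) (out := out) r false .right hds hh hpos hs hlt
      obtain ⟨pre', suf', he, h2⟩ := ih
        (ds := Function.update ds r (pre ++ false :: (true :: suf).tail))
        (hd := Function.update hd r (HeadMove.right.apply (hd r))) (pre ++ [false]) (by simp)
        (by simp [HeadMove.apply, hh]) (update_head_lt hs r hlt)
        (by simpa [digitsSucc] using hlen)
      refine ⟨pre', suf', by simpa [digitsSucc] using he, ?_⟩
      rw [Function.update_idem, Function.update_idem] at h2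
      exact Run.loop_step hpos
        (by simp [Store.cells, counterStore, counterCell, hds, hh]) h1 h2

theorem run_incTape (r : Fin K) (hpos : pos ≤ w.length + 1)
    (hlen : (digitsSucc (ds r)).length < s) :
    (incTape r).Run w s (counterStore pos ds (fun _ => 0) out)
      (counterStore pos (Function.update ds r (digitsSucc (ds r))) (fun _ => 0) out) := by
  have h0 : 0 < s := by omega
  obtain ⟨pre, suf, he, h1⟩ := run_incTape_loop (hd := fun _ => 0) (out := out) r hpos [] (ds r)
    rfl rfl (fun _ => h0) hlen
  have hlt : pre.length < s := by
    have := congrArg List.length he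
    simp at this
    omega
  have hs := update_head_lt (hd := fun _ => 0) (fun _ => h0) r hlt
  have h2 := run_writeOp (w := w) (out := out) (ds := Function.update ds r (pre ++ suf))
    (hd := Function.update (fun _ => 0) r pre.length) (pre := pre) (suf := suf) r true .stay
    (by simp) (by simp) hpos hs (by simpa [HeadMove.apply] using hlt)
  have h3 := run_home (w := w) (ds := Function.update ds r (digitsSucc (ds r))) (out := out) r
    hpos hs
  simp only [HeadMove.apply, Function.update_self, Function.update_idem, he,
    List.nil_append] at h2
  simp only [Function.update_idem, Function.update_eq_self] at h3
  exact h1.seq (h2.seq h3)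

/-- Set the counter on tape `r` to `0`. -/
def clearTape (r : Fin K) : Frag K :=
  (loop (fun _ s => (s r).2.isSome) (writeOp r false .right)).seq (home r)

/-- Digits are replaced by zeros and not erased: the list keeps its length, and with it the space
bound. -/
theorem run_clearTape_loop (r : Fin K) (hpos : pos ≤ w.length + 1) (pre suf : List Bool)
    (hds : ds r = pre ++ suf) (hh : hd r = pre.length) (hs : ∀ t, hd t < s)
    (hlen : (pre ++ suf).length < s) :
    (loop (fun _ s => (s r).2.isSome) (writeOp r false .right)).Run w s
      (counterStore pos ds hd out)
      (counterStore pos (Function.update ds r (pre ++ List.replicate suf.length false))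
        (Function.update hd r (pre ++ suf).length) out) := by
  induction suf generalizing pre ds hd with
  | nil =>
    simp only [List.length_nil, List.replicate_zero]
    rw [← hds, Function.update_eq_self, hds, List.append_nil, ← hh, Function.update_eq_self]
    exact Run.loop_exit hpos (by simp [Store.cells, counterStore, counterCell, hds, hh]) hs
  | cons b suf ih =>
    have hlt : HeadMove.right.apply (hd r) < s := by
      simp at hlen
      simp [HeadMove.apply, hh]
      omega
    have h1 := run_writeOp (w := w) (out := out) r false .right hds hh hpos hs hlt
    have h2 := ih
      (ds := Function.update ds r (pre ++ false :: (b :: suf).tail))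
      (hd := Function.update hd r (HeadMove.right.apply (hd r))) (pre ++ [false]) (by simp)
      (by simp [HeadMove.apply, hh]) (update_head_lt hs r hlt)
      (by simpa using hlen)
    rw [Function.update_idem, Function.update_idem] at h2
    have h3 := Run.loop_step (test := fun _ s => (s r).2.isSome) hpos
      (by simp [Store.cells, counterStore, counterCell, hds, hh]) h1 h2
    simpa [List.replicate_succ] using h3

theorem run_clearTape (r : Fin K) (hpos : pos ≤ w.length + 1) (hlen : (ds r).length < s) :
    (clearTape r).Run w s (counterStore pos ds (fun _ => 0) out)
      (counterStore pos (Function.update ds r (List.replicate (ds r).length false))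
        (fun _ => 0) out) := by
  have h0 : 0 < s := by omega
  have h1 := run_clearTape_loop (hd := fun _ => 0) (out := out) r hpos [] (ds r)
    rfl rfl (fun _ => h0) hlen
  have hs := update_head_lt (hd := fun _ => 0) (fun _ => h0) r hlen
  have h2 := run_home (w := w) (ds := Function.update ds r (List.replicate (ds r).length false))
    (out := out) r hpos hs
  simp only [Function.update_idem, Function.update_eq_self] at h2
  exact h1.seq h2

/-- Scan the tapes `a` and `b` up to the first difference or up to the end. -/
def scan (a b : Fin K) : Frag K :=
  loop (fun _ s => ((s a).2.isSome || (s b).2.isSome) &&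
    ((s a).2.getD false == (s b).2.getD false)) ((moveOp a .right).seq (moveOp b .right))

/-- Heads at cell `i` on the tapes `a` and `b`, and at cell `0` on all others. -/
def heads (a b : Fin K) (i : ℕ) : Fin K → ℕ :=
  Function.update (Function.update (fun _ => 0) a i) b i

theorem heads_lt (a b : Fin K) {i : ℕ} (hi : i < s) : ∀ t, heads a b i t < s :=
  update_head_lt (update_head_lt (fun _ => by omega) a hi) b hi

theorem heads_left {a b : Fin K} (i : ℕ) : heads a b i a = i := by
  simp [heads, Function.update_apply]

theorem heads_right {a b : Fin K} (i : ℕ) : heads a b i b = i := by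
  simp [heads]

theorem heads_zero (a b : Fin K) : heads a b 0 = fun _ => 0 := by
  simp [heads]

/-- The cell where the scan stops carries the verdict: it is blank on both tapes exactly if no
difference was met. Blank cells are read as `0`, so the scan continues past the end of the shorter
list. -/
theorem run_scan {a b : Fin K} (hab : a ≠ b) (hpos : pos ≤ w.length + 1) {L : ℕ}
    (hL : ∀ t, (ds t).length ≤ L) (i : ℕ) (hi : i ≤ L) :
    ∃ j ≤ L, ((ds a)[j]? = none ∧ (ds b)[j]? = none ↔
        digitsVal ((ds a).drop i) = digitsVal ((ds b).drop i)) ∧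
      (scan a b).Run w (L + 1) (counterStore pos ds (heads a b i) out)
        (counterStore pos ds (heads a b j) out) := by
  induction hk : L - i generalizing i with
  | zero =>
    have hi' : i = L := by omega
    have ha : (ds a)[i]? = none := List.getElem?_eq_none (by have := hL a; omega)
    have hb : (ds b)[i]? = none := List.getElem?_eq_none (by have := hL b; omega)
    refine ⟨i, hi, ?_, ?_⟩
    · rw [List.drop_eq_nil_of_le (by have := hL a; omega),
        List.drop_eq_nil_of_le (by have := hL b; omega)]
      simp only [ha, hb, and_self]
    · refine Run.loop_exit hpos ?_ (heads_lt a b (by omega))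
      simp [Store.cells, counterStore, counterCell, heads_left, heads_right, ha, hb]
  | succ k ih =>
    by_cases hn : (ds a)[i]? = none ∧ (ds b)[i]? = none
    · refine ⟨i, hi, ?_, ?_⟩
      · rw [List.drop_eq_nil_of_le (List.getElem?_eq_none_iff.1 hn.1),
          List.drop_eq_nil_of_le (List.getElem?_eq_none_iff.1 hn.2)]
        simp only [hn, and_self]
      · refine Run.loop_exit hpos ?_ (heads_lt a b (by omega))
        simp [Store.cells, counterStore, counterCell, heads_left, heads_right, hn.1, hn.2]
    · by_cases he : (ds a)[i]?.getD false = (ds b)[i]?.getD false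
      · obtain ⟨j, hj, hiff, hrun⟩ := ih (i + 1) (by omega) (by omega)
        refine ⟨j, hj, ?_, ?_⟩
        · rw [hiff, digitsVal_drop (ds a) i, digitsVal_drop (ds b) i, he]
          omega
        · have h1 := run_moveOp (w := w) (ds := ds) (out := out) (s := L + 1) (pos := pos)
            (hd := heads a b i) a .right hpos (heads_lt a b (by omega))
            (by simp [HeadMove.apply, heads_left]; omega)
          have h2 := run_moveOp (w := w) (ds := ds) (out := out) (s := L + 1) (pos := pos)
            (hd := Function.update (heads a b i) a (HeadMove.right.apply (heads a b i a))) b .right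
            hpos (update_head_lt (heads_lt a b (by omega)) a
              (by simp [HeadMove.apply, heads_left]; omega))
            (by simp [HeadMove.apply, heads_right, hab.symm]; omega)
          have hh : Function.update (Function.update (heads a b i) a
              (HeadMove.right.apply (heads a b i a))) b (HeadMove.right.apply
                (Function.update (heads a b i) a (HeadMove.right.apply (heads a b i a)) b)) =
              heads a b (i + 1) := by
            rw [Function.update_of_ne hab.symm, heads_left, heads_right]
            funext t
            simp only [heads, HeadMove.apply, Function.update_apply]
            split_ifs <;> rfl
          rw [hh] at h2
          refine Run.loop_step hpos ?_ (h1.seq h2) hrun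
          simp only [Store.cells, counterStore, counterCell, heads_left, heads_right, he,
            beq_self_eq_true, Bool.and_true, Bool.or_eq_true]
          by_contra hc
          push Not at hc
          exact hn ⟨by simpa using hc.1, by simpa using hc.2⟩
      · refine ⟨i, hi, ?_, ?_⟩
        · refine iff_of_false hn fun h => he ?_
          rw [digitsVal_drop (ds a) i, digitsVal_drop (ds b) i] at h
          cases hx : (ds a)[i]?.getD false <;> cases hy : (ds b)[i]?.getD false <;>
            simp only [hx, hy, Bool.toNat_true, Bool.toNat_false] at h ⊢ <;> omega
        · refine Run.loop_exit hpos ?_ (heads_lt a b (by omega))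
          simp [Store.cells, counterStore, counterCell, heads_left, heads_right, he]

/-- Return both heads after `scan`. -/
def homeBoth (a b : Fin K) : Frag K := (home a).seq (home b)

theorem run_homeBoth {a b : Fin K} (hpos : pos ≤ w.length + 1) {i : ℕ} (hi : i < s) :
    (homeBoth a b).Run w s (counterStore pos ds (heads a b i) out)
      (counterStore pos ds (fun _ => 0) out) := by
  have h1 := run_home (w := w) (ds := ds) (out := out) a hpos (heads_lt a b hi)
  have h2 := run_home (w := w) (ds := ds) (out := out) b hpos
    (update_head_lt (heads_lt a b hi) a (by omega : 0 < s))
  have hh : Function.update (Function.update (heads a b i) a 0) b 0 = fun _ => 0 := by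
    funext t
    simp only [heads, Function.update_apply]
    split_ifs <;> rfl
  rw [hh] at h2
  exact h1.seq h2

/-- After `scan`: have the counters on the tapes `a` and `b` been found equal? -/
def scanTest (a b : Fin K) : InputCell → (Fin K → CounterSym) → Bool :=
  fun _ s => (s a).2.isNone && (s b).2.isNone

theorem scanTest_eq_true {a b : Fin K} {c : InputCell} {i : ℕ} :
    scanTest a b c (counterStore pos ds (heads a b i) out).cells = true ↔
      (ds a)[i]? = none ∧ (ds b)[i]? = none := by
  simp [scanTest, Store.cells, counterStore, counterCell, heads_left, heads_right]

/-- Compare two counters. -/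
def ifEqTape (a b : Fin K) (F G : Frag K) : Frag K :=
  (scan a b).seq (branch (scanTest a b) ((homeBoth a b).seq F) ((homeBoth a b).seq G))

/-- Repeat as long as two counters are different. -/
def whileNeTape (a b : Fin K) (F : Frag K) : Frag K :=
  (scan a b).seq ((loop (fun c s => !scanTest a b c s)
    ((homeBoth a b).seq (F.seq (scan a b)))).seq (homeBoth a b))

end Frag

/-! ### Register programs -/

/-- The contents of the registers, the position of the input head, and the output. -/
structure RegState where
  reg : ℕ → ℕ
  pos : ℕ
  out : List Bool

/-- Assign a value to a register. -/
def RegState.set (s : RegState) (r x : ℕ) : RegState :=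
  { s with reg := Function.update s.reg r x }

@[simp] theorem RegState.set_reg_self (s : RegState) (r x : ℕ) : (s.set r x).reg r = x := by
  simp [RegState.set]

theorem RegState.set_reg_of_ne (s : RegState) {r t : ℕ} (x : ℕ) (h : t ≠ r) :
    (s.set r x).reg t = s.reg t := by
  simp [RegState.set, h]

@[simp] theorem RegState.set_out (s : RegState) (r x : ℕ) : (s.set r x).out = s.out := rfl

namespace Frag

variable {K : ℕ}

/-- The store `d` represents the register state `s`, with counters of length at most `L`. -/
def Represents (w : List Bool) (L : ℕ) (s : RegState) (d : Store K) : Prop :=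
  s.pos ≤ w.length + 1 ∧ ∃ ds : Fin K → List Bool,
    (∀ t, (ds t).length ≤ L) ∧ (∀ t : Fin K, digitsVal (ds t) = s.reg t) ∧
    d = counterStore s.pos ds (fun _ => 0) s.out

/-- From the register state `s` the fragment reaches its exit in a state that satisfies `Q`. -/
def WP (F : Frag K) (w : List Bool) (L : ℕ) (s : RegState) (Q : RegState → Prop) : Prop :=
  ∀ d, Represents w L s d → ∃ s' d', Q s' ∧ Represents w L s' d' ∧ F.Run w (L + 1) d d'

variable {F G : Frag K} {w : List Bool} {L : ℕ} {s : RegState} {Q R : RegState → Prop}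

theorem WP.mono (h : F.WP w L s Q) (hQ : ∀ s', Q s' → R s') : F.WP w L s R := by
  intro d hd
  obtain ⟨s', d', h1, h2, h3⟩ := h d hd
  exact ⟨s', d', hQ _ h1, h2, h3⟩

theorem WP.seq (h : F.WP w L s Q) (h' : ∀ s', Q s' → G.WP w L s' R) : (F.seq G).WP w L s R := by
  intro d hd
  obtain ⟨s', d', h1, h2, h3⟩ := h d hd
  obtain ⟨s'', d'', h4, h5, h6⟩ := h' s' h1 d' h2
  exact ⟨s'', d'', h4, h5, h3.seq h6⟩

/-- Do nothing. -/
def skip : Frag K := single .stay id (fun _ => .stay) none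

theorem wp_skip (h : Q s) : (skip : Frag K).WP w L s Q := by
  rintro d ⟨hpos, ds, hL, hv, rfl⟩
  refine ⟨s, _, h, ⟨hpos, ds, hL, hv, rfl⟩,
    run_single (fun _ => Nat.succ_pos L) ?_ (fun _ => Nat.succ_pos L)⟩
  exact Store.act_idle hpos ()

/-- Append a bit to the output. -/
def emit (b : Bool) : Frag K := single .stay id (fun _ => .stay) (some b)

theorem wp_emit (b : Bool) (h : Q { s with out := s.out ++ [b] }) :
    (emit b : Frag K).WP w L s Q := by
  rintro d ⟨hpos, ds, hL, hv, rfl⟩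
  refine ⟨_, _, h, ⟨hpos, ds, hL, hv, rfl⟩,
    run_single (fun _ => Nat.succ_pos L) ?_ (fun _ => Nat.succ_pos L)⟩
  apply Store.ext
  · exact min_eq_left hpos
  · funext t
    exact Function.update_eq_self _ _
  · rfl
  · rfl

/-- Move the input head. -/
def moveInput (m : HeadMove) : Frag K := single m id (fun _ => .stay) none

theorem wp_moveInput (m : HeadMove)
    (h : Q { s with pos := min (m.apply s.pos) (w.length + 1) }) :
    (moveInput m : Frag K).WP w L s Q := by
  rintro d ⟨hpos, ds, hL, hv, rfl⟩
  refine ⟨_, _, h, ⟨min_le_right _ _, ds, hL, hv, rfl⟩,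
    run_single (fun _ => Nat.succ_pos L) ?_ (fun _ => Nat.succ_pos L)⟩
  apply Store.ext
  · rfl
  · funext t
    exact Function.update_eq_self _ _
  · rfl
  · exact List.append_nil _

/-- Branch on the scanned input cell. -/
def ifInput (test : InputCell → Bool) (F G : Frag K) : Frag K := branch (fun c _ => test c) F G

theorem wp_ifInput {test : InputCell → Bool}
    (hF : test (inputCell w s.pos) = true → F.WP w L s Q)
    (hG : test (inputCell w s.pos) = false → G.WP w L s Q) : (ifInput test F G).WP w L s Q := by
  intro d hd
  have hpos : d.inputPos = s.pos := by
    obtain ⟨-, ds, -, -, rfl⟩ := hd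
    rfl
  have hle : d.inputPos ≤ w.length + 1 := hpos ▸ hd.1
  cases ht : test (inputCell w s.pos)
  · obtain ⟨s', d', h1, h2, h3⟩ := hG ht d hd
    exact ⟨s', d', h1, h2, Run.branch_false hle (by rwa [hpos]) h3⟩
  · obtain ⟨s', d', h1, h2, h3⟩ := hF ht d hd
    exact ⟨s', d', h1, h2, Run.branch_true hle (by rwa [hpos]) h3⟩

/-- Loop as long as the scanned input cell passes a test. -/
def whileInput (test : InputCell → Bool) (F : Frag K) : Frag K := loop (fun c _ => test c) F

/-- The index of `I` is the number of iterations still to come, which builds termination into the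
invariant. -/
theorem wp_whileInput {test : InputCell → Bool} (I : ℕ → RegState → Prop) (N : ℕ) (h0 : I N s)
    (hstep : ∀ k s, I (k + 1) s → test (inputCell w s.pos) = true ∧ F.WP w L s (I k))
    (hend : ∀ s, I 0 s → test (inputCell w s.pos) = false) :
    (whileInput test F).WP w L s (I 0) := by
  intro d hd
  induction N generalizing s d with
  | zero =>
    refine ⟨s, d, h0, hd, ?_⟩
    obtain ⟨hpos, ds, -, -, rfl⟩ := hd
    exact Run.loop_exit hpos (hend s h0) (fun _ => Nat.succ_pos L)
  | succ N ih =>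
    obtain ⟨ht, hF⟩ := hstep N s h0
    obtain ⟨s', d', h1, h2, h3⟩ := hF d hd
    obtain ⟨s'', d'', h4, h5, h6⟩ := ih h1 d' h2
    refine ⟨s'', d'', h4, h5, ?_⟩
    obtain ⟨hpos, ds, -, -, rfl⟩ := hd
    exact Run.loop_step hpos ht h3 h6

/-- A fragment that works on the tape of a register. -/
def onTape (r : ℕ) (f : Fin K → Frag K) : Frag K := if h : r < K then f ⟨r, h⟩ else skip

theorem onTape_eq {r : ℕ} (h : r < K) (f : Fin K → Frag K) : onTape r f = f ⟨r, h⟩ := dif_pos h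

theorem represents_set {ds : Fin K → List Bool} {r x : ℕ} (hr : r < K) {l : List Bool}
    (hpos : s.pos ≤ w.length + 1) (hL : ∀ t, (ds t).length ≤ L)
    (hv : ∀ t : Fin K, digitsVal (ds t) = s.reg t) (hlL : l.length ≤ L)
    (hlx : digitsVal l = x) :
    Represents w L (s.set r x)
      (counterStore s.pos (Function.update ds ⟨r, hr⟩ l) (fun _ => 0) s.out) := by
  refine ⟨hpos, _, fun t => ?_, fun t => ?_, rfl⟩
  · rcases eq_or_ne t ⟨r, hr⟩ with rfl | h
    · simpa using hlL
    · simpa [h] using hL t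
  · rcases eq_or_ne t ⟨r, hr⟩ with rfl | h
    · simpa using hlx
    · rw [Function.update_of_ne h, RegState.set_reg_of_ne, hv]
      exact fun e => h (Fin.ext e)

/-- Set a register to `0`. -/
def clear (r : ℕ) : Frag K := onTape r clearTape

theorem wp_clear {r : ℕ} (hr : r < K) (h : Q (s.set r 0)) : (clear r : Frag K).WP w L s Q := by
  rintro d ⟨hpos, ds, hL, hv, rfl⟩
  rw [clear, onTape_eq hr]
  exact ⟨_, _, h, represents_set hr hpos hL hv (by simpa using hL ⟨r, hr⟩)
    (digitsVal_replicate _), run_clearTape _ hpos (Nat.lt_succ_of_le (hL _))⟩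

/-- Increase a register. -/
def inc (r : ℕ) : Frag K := onTape r incTape

theorem wp_inc {r : ℕ} (hr : r < K) (hlt : s.reg r + 1 < 2 ^ L) (h : Q (s.set r (s.reg r + 1))) :
    (inc r : Frag K).WP w L s Q := by
  rintro d ⟨hpos, ds, hL, hv, rfl⟩
  rw [inc, onTape_eq hr]
  have hlen := length_digitsSucc_le (hL ⟨r, hr⟩) (by rw [hv]; exact hlt)
  exact ⟨_, _, h, represents_set hr hpos hL hv hlen (by rw [digitsVal_succ, hv]),
    run_incTape _ hpos (Nat.lt_succ_of_le hlen)⟩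

/-- Compare two registers. -/
def ifEq (a b : ℕ) (F G : Frag K) : Frag K := onTape a fun a => onTape b fun b => ifEqTape a b F G

theorem exists_run_scan {a b : Fin K} (hab : a ≠ b) {ds : Fin K → List Bool}
    (hpos : s.pos ≤ w.length + 1) (hL : ∀ t, (ds t).length ≤ L)
    (hv : ∀ t : Fin K, digitsVal (ds t) = s.reg t) (c : InputCell) :
    ∃ j ≤ L, (scanTest a b c (counterStore s.pos ds (heads a b j) s.out).cells = true ↔
        s.reg a = s.reg b) ∧
      (scan a b).Run w (L + 1) (counterStore s.pos ds (fun _ => 0) s.out)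
        (counterStore s.pos ds (heads a b j) s.out) := by
  obtain ⟨j, hj, hiff, hrun⟩ := run_scan (w := w) (out := s.out) hab hpos hL 0 (Nat.zero_le L)
  rw [heads_zero] at hrun
  refine ⟨j, hj, ?_, hrun⟩
  rw [scanTest_eq_true, hiff, List.drop_zero, List.drop_zero, hv, hv]

theorem wp_ifEq {a b : ℕ} (ha : a < K) (hb : b < K) (hab : a ≠ b)
    (hF : s.reg a = s.reg b → F.WP w L s Q) (hG : s.reg a ≠ s.reg b → G.WP w L s Q) :
    (ifEq a b F G).WP w L s Q := by
  intro d hd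
  have hd' := hd
  obtain ⟨hpos, ds, hL, hv, rfl⟩ := hd'
  rw [ifEq, onTape_eq ha, onTape_eq hb]
  obtain ⟨j, hj, hiff, hrun⟩ := exists_run_scan (a := ⟨a, ha⟩) (b := ⟨b, hb⟩)
    (by simpa using hab) hpos hL hv (inputCell w s.pos)
  have hhome := run_homeBoth (w := w) (ds := ds) (out := s.out) (a := ⟨a, ha⟩) (b := ⟨b, hb⟩)
    hpos (Nat.lt_succ_of_le hj)
  by_cases h : s.reg a = s.reg b
  · obtain ⟨s', d', h1, h2, h3⟩ := hF h _ hd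
    exact ⟨s', d', h1, h2, hrun.seq (Run.branch_true hpos (hiff.2 h) (hhome.seq h3))⟩
  · obtain ⟨s', d', h1, h2, h3⟩ := hG h _ hd
    exact ⟨s', d', h1, h2, hrun.seq (Run.branch_false hpos
      (Bool.eq_false_iff.2 fun e => h (hiff.1 e)) (hhome.seq h3))⟩

/-- Repeat as long as two registers are different. -/
def whileNe (a b : ℕ) (F : Frag K) : Frag K := onTape a fun a => onTape b fun b => whileNeTape a b F

theorem wp_whileNe {a b : ℕ} (ha : a < K) (hb : b < K) (hab : a ≠ b)
    (I : ℕ → RegState → Prop) (N : ℕ) (h0 : I N s)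
    (hstep : ∀ k s, I (k + 1) s → s.reg a ≠ s.reg b ∧ F.WP w L s (I k))
    (hend : ∀ s, I 0 s → s.reg a = s.reg b) : (whileNe a b F).WP w L s (I 0) := by
  rintro d ⟨hpos, ds, hL, hv, rfl⟩
  rw [whileNe, onTape_eq ha, onTape_eq hb]
  have hab' : (⟨a, ha⟩ : Fin K) ≠ ⟨b, hb⟩ := by simpa using hab
  generalize hA : (⟨a, ha⟩ : Fin K) = A at hab'
  generalize hB : (⟨b, hb⟩ : Fin K) = B at hab'
  have hA' : a = A := by rw [← hA]
  have hB' : b = B := by rw [← hB]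
  -- The comparison is a scan made before the loop and again at the end of each body. Whenever the
  -- loop test is made, the two heads therefore rest where the last scan stopped, and the stores are
  -- not yet of the form required by `Represents`.
  have main : ∀ N s ds, I N s → s.pos ≤ w.length + 1 → (∀ t, (ds t).length ≤ L) →
      (∀ t : Fin K, digitsVal (ds t) = s.reg t) → ∀ j ≤ L,
      (scanTest A B (inputCell w s.pos) (counterStore s.pos ds (heads A B j) s.out).cells = true ↔
        s.reg A = s.reg B) →
      ∃ s' ds' j', I 0 s' ∧ s'.pos ≤ w.length + 1 ∧ (∀ t, (ds' t).length ≤ L) ∧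
        (∀ t : Fin K, digitsVal (ds' t) = s'.reg t) ∧ j' ≤ L ∧
        (loop (fun c s => !scanTest A B c s) ((homeBoth A B).seq (F.seq (scan A B)))).Run w (L + 1)
          (counterStore s.pos ds (heads A B j) s.out)
          (counterStore s'.pos ds' (heads A B j') s'.out) := by
    intro N
    induction N with
    | zero =>
      intro s ds hI hpos hL hv j hj hiff
      refine ⟨s, ds, j, hI, hpos, hL, hv, hj,
        Run.loop_exit hpos ?_ (heads_lt A B (Nat.lt_succ_of_le hj))⟩
      have := hend s hI
      rw [hA', hB'] at this
      exact congrArg (!·) (hiff.2 this)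
    | succ N ih =>
      intro s ds hI hpos hL hv j hj hiff
      obtain ⟨hne, hF⟩ := hstep N s hI
      rw [hA', hB'] at hne
      obtain ⟨s', d', h1, ⟨hpos', ds', hL', hv', rfl⟩, h3⟩ := hF _ ⟨hpos, ds, hL, hv, rfl⟩
      obtain ⟨j', hj', hiff', hrun'⟩ := exists_run_scan hab' hpos' hL' hv' (inputCell w s'.pos)
      obtain ⟨s'', ds'', j'', h4, h5, h6, h7, h8, h9⟩ := ih s' ds' h1 hpos' hL' hv' j' hj' hiff'
      refine ⟨s'', ds'', j'', h4, h5, h6, h7, h8, Run.loop_step hpos ?_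
        ((run_homeBoth hpos (Nat.lt_succ_of_le hj)).seq (h3.seq hrun')) h9⟩
      exact congrArg (!·) (Bool.eq_false_iff.2 fun e => hne (hiff.1 e))
  obtain ⟨j, hj, hiff, hrun⟩ := exists_run_scan hab' hpos hL hv (inputCell w s.pos)
  obtain ⟨s', ds', j', h1, h2, h3, h4, h5, h6⟩ := main N s ds h0 hpos hL hv j hj hiff
  exact ⟨s', _, h1, ⟨h2, ds', h3, h4, rfl⟩,
    hrun.seq (h6.seq (run_homeBoth h2 (Nat.lt_succ_of_le h5)))⟩

/-- Execute a fragment for `i = 0, …, n - 1`, where `n` is the content of a register. -/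
def forLoop (i n : ℕ) (F : Frag K) : Frag K := (clear i).seq (whileNe i n (F.seq (inc i)))

/-- The body may use the registers `i` and `n` if it restores them. The last condition on the body
refers to the state after the increment, which is why `I (k + 1)` is asked of `s'.set i (k + 1)`. -/
theorem wp_forLoop {i n : ℕ} (hi : i < K) (hn : n < K) (hin : i ≠ n) {N : ℕ}
    (hN : s.reg n = N) (hlt : N < 2 ^ L) (I : ℕ → RegState → Prop) (h0 : I 0 (s.set i 0))
    (hstep : ∀ k < N, ∀ s, s.reg i = k → s.reg n = N → I k s →
      F.WP w L s fun s' => s'.reg i = k ∧ s'.reg n = N ∧ I (k + 1) (s'.set i (k + 1))) :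
    (forLoop i n F).WP w L s fun s' => s'.reg i = N ∧ s'.reg n = N ∧ I N s' := by
  refine WP.seq (wp_clear (Q := fun s' => s' = s.set i 0) hi rfl) ?_
  rintro _ rfl
  refine (wp_whileNe hi hn hin
    -- `wp_whileNe` counts the remaining iterations, whereas `I` counts the completed ones.
    (fun m s => m ≤ N ∧ s.reg i = N - m ∧ s.reg n = N ∧ I (N - m) s) N ?_ ?_ ?_).mono ?_
  · refine ⟨le_rfl, ?_, ?_, ?_⟩
    · simp
    · rw [RegState.set_reg_of_ne _ _ hin.symm, hN]
    · simpa using h0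
  · rintro m t ⟨hm, h1, h2, h3⟩
    refine ⟨by omega, ?_⟩
    refine WP.seq (hstep (N - (m + 1)) (by omega) t h1 h2 h3) ?_
    rintro t' ⟨h4, h5, h6⟩
    have he : N - (m + 1) + 1 = N - m := by omega
    refine wp_inc hi (by omega) ⟨by omega, ?_, ?_, ?_⟩
    · rw [RegState.set_reg_self, h4, he]
    · rw [RegState.set_reg_of_ne _ _ hin.symm, h5]
    · rw [h4, ← he]
      exact h6
  · rintro t ⟨-, h1, h2, -⟩
    omega
  · rintro t ⟨-, h1, h2, h3⟩
    exact ⟨h1, h2, h3⟩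

/-! ### Access to the input -/

/-- Is this the left end marker? -/
def isLeftEnd : InputCell → Bool
  | .leftEnd => true
  | _ => false

/-- Is this the right end marker? -/
def isRightEnd : InputCell → Bool
  | .rightEnd => true
  | _ => false

/-- Is this the bit `1`? -/
def isOne : InputCell → Bool
  | .bit b => b
  | _ => false

theorem isLeftEnd_inputCell (w : List Bool) (i : ℕ) :
    isLeftEnd (inputCell w i) = decide (i = 0) := by
  rcases i with _ | i
  · rfl
  · rcases h : w[i]? with _ | b <;> simp [inputCell, h, isLeftEnd]

theorem isRightEnd_inputCell (w : List Bool) (i : ℕ) :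
    isRightEnd (inputCell w i) = decide (w.length + 1 ≤ i) := by
  rcases i with _ | i
  · simp [inputCell, isRightEnd]
  · rcases h : w[i]? with _ | b
    · have := List.getElem?_eq_none_iff.1 h
      simpa [inputCell, h, isRightEnd] using this
    · have : i < w.length := (List.getElem?_eq_some_iff.1 h).1
      simpa [inputCell, h, isRightEnd] using this

theorem isOne_inputCell (w : List Bool) (i : ℕ) :
    isOne (inputCell w (i + 1)) = (w[i]?.getD false) := by
  rcases h : w[i]? with _ | b <;> simp [inputCell, h, isOne]

/-- Move the input head to the first bit. -/
def rewind : Frag K := (whileInput (fun c => !isLeftEnd c) (moveInput .left)).seq (moveInput .right)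

/-- The bound on the head position is part of `Represents` and may therefore be assumed. -/
theorem WP.of_pos (h : s.pos ≤ w.length + 1 → F.WP w L s Q) : F.WP w L s Q :=
  fun d hd => h hd.1 d hd

theorem wp_rewind (h : Q { s with pos := 1 }) :
    (rewind : Frag K).WP w L s Q := by
  refine WP.of_pos fun hs => ?_
  refine WP.seq (wp_whileInput (fun k t => t = { s with pos := k } ∧ k ≤ w.length + 1) s.pos
    ⟨rfl, hs⟩ ?_ ?_) ?_
  · rintro k t ⟨rfl, hk⟩
    refine ⟨by simp [isLeftEnd_inputCell], wp_moveInput _ ⟨?_, by omega⟩⟩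
    simp [HeadMove.apply]
    omega
  · rintro t ⟨rfl, -⟩
    simp [isLeftEnd_inputCell]
  · rintro t ⟨rfl, -⟩
    refine wp_moveInput _ ?_
    simpa [HeadMove.apply] using h

/-- The length of the input. -/
def readLength (r : ℕ) : Frag K :=
  (clear r).seq (rewind.seq (whileInput (fun c => !isRightEnd c) ((moveInput .right).seq (inc r))))

theorem wp_readLength {r : ℕ} (hr : r < K) (hlt : w.length < 2 ^ L)
    (h : Q { s.set r w.length with pos := w.length + 1 }) : (readLength r : Frag K).WP w L s Q := by
  refine WP.seq (wp_clear (Q := fun t => t = s.set r 0) hr rfl) ?_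
  rintro _ rfl
  refine WP.seq (wp_rewind (Q := fun t => t = { s.set r 0 with pos := 1 }) rfl) ?_
  rintro _ rfl
  refine (wp_whileInput (fun k t => k ≤ w.length ∧
    t = { s.set r (w.length - k) with pos := w.length - k + 1 }) w.length ?_ ?_ ?_).mono ?_
  · simp
  · rintro k t ⟨hk, rfl⟩
    refine ⟨by simp [isRightEnd_inputCell]; omega, ?_⟩
    refine WP.seq (wp_moveInput (Q := fun t => t = { s.set r (w.length - (k + 1)) with
      pos := w.length - k + 1 }) .right ?_) ?_
    · simp [HeadMove.apply]
      omega
    · rintro _ rfl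
      refine wp_inc hr ?_ ⟨by omega, ?_⟩
      · simp; omega
      · have he : w.length - (k + 1) + 1 = w.length - k := by omega
        simp [RegState.set, he]
  · rintro t ⟨-, rfl⟩
    simp [isRightEnd_inputCell]
  · rintro t ⟨-, rfl⟩
    exact h

/-- Move the input head to the bit whose index is in register `n`, with the help of
register `i`. -/
def seek (i n : ℕ) : Frag K := rewind.seq (forLoop i n (moveInput .right))

/-- Bit `n` is in cell `n + 1`, that is, `n` moves from the first bit. For an index beyond the word
the head is held at the right end marker. -/
theorem wp_seek {i n : ℕ} (hi : i < K) (hn : n < K) (hin : i ≠ n)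
    (hlt : s.reg n < 2 ^ L)
    (h : Q { s.set i (s.reg n) with pos := min (s.reg n + 1) (w.length + 1) }) :
    (seek i n : Frag K).WP w L s Q := by
  refine WP.seq (wp_rewind (Q := fun t => t = { s with pos := 1 }) rfl) ?_
  rintro _ rfl
  refine (wp_forLoop (s := { s with pos := 1 }) hi hn hin rfl hlt
    (fun k t => t = { s.set i k with pos := min (k + 1) (w.length + 1) }) ?_ ?_).mono ?_
  · simp [RegState.set]
  · rintro k hk _ - h2 rfl
    refine wp_moveInput _ ⟨by simp, h2, ?_⟩
    simp [RegState.set, HeadMove.apply]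
    omega
  · rintro _ ⟨-, -, rfl⟩
    exact h

end Frag

/-! ### A language of logarithmic space computations -/

/-- The least `i < n` with `f i ≠ 0`, or `n` if there is none. -/
def leastBelow (f : ℕ → ℕ) : ℕ → ℕ
  | 0 => 0
  | n + 1 => if leastBelow f n = n ∧ f n = 0 then n + 1 else leastBelow f n

theorem leastBelow_le (f : ℕ → ℕ) (n : ℕ) : leastBelow f n ≤ n := by
  induction n with
  | zero => exact le_rfl
  | succ n ih =>
    rw [leastBelow]
    split_ifs <;> omega

theorem eq_zero_of_lt_leastBelow {f : ℕ → ℕ} {n i : ℕ} (h : i < leastBelow f n) : f i = 0 := by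
  induction n with
  | zero => simp [leastBelow] at h
  | succ n ih =>
    rw [leastBelow] at h
    split_ifs at h with hc
    · rcases Nat.lt_succ_iff_lt_or_eq.1 h with h' | rfl
      · exact ih (by omega)
      · exact hc.2
    · exact ih h

theorem leastBelow_ne_zero {f : ℕ → ℕ} {n : ℕ} (h : leastBelow f n < n) :
    f (leastBelow f n) ≠ 0 := by
  induction n with
  | zero => simp at h
  | succ n ih =>
    rw [leastBelow] at h ⊢
    split_ifs at h ⊢ with hc
    · omega
    · rcases Nat.lt_succ_iff_lt_or_eq.1 h with h' | h'
      · exact ih h'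
      · rw [h']
        exact fun h0 => hc ⟨h', h0⟩

theorem leastBelow_eq {f : ℕ → ℕ} {n m : ℕ} (hm : m ≤ n) (h0 : ∀ i < m, f i = 0)
    (h1 : m < n → f m ≠ 0) : leastBelow f n = m := by
  rcases lt_trichotomy (leastBelow f n) m with h | h | h
  · exact absurd (h0 _ h) (leastBelow_ne_zero (by omega))
  · exact h
  · exact absurd (eq_zero_of_lt_leastBelow h) (h1 (by have := leastBelow_le f n; omega))

/-- Arithmetical expressions over the input word; a truth value is a number, false being `0`. -/
inductive Ex where
  /-- a variable -/
  | var (x : ℕ)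
  /-- a constant -/
  | const (c : ℕ)
  /-- the length of the input -/
  | len
  /-- addition -/
  | add (a b : Ex)
  /-- multiplication -/
  | mul (a b : Ex)
  /-- equality -/
  | eq (a b : Ex)
  /-- inequality -/
  | lt (a b : Ex)
  /-- the bit of the input with a given index -/
  | bit (a : Ex)
  /-- the least `x` below a bound with a given property, or the bound -/
  | find (x : ℕ) (a φ : Ex)

/-- Programs that write a word. -/
inductive WordProg where
  /-- write nothing -/
  | nil
  /-- write a bit -/
  | emit (b : Bool)
  /-- write two words -/
  | seq (p q : WordProg)
  /-- distinguish two cases -/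
  | ite (φ : Ex) (p q : WordProg)
  /-- write words for `x = 0, 1, …` below a bound -/
  | loop (x : ℕ) (a : Ex) (p : WordProg)
  /-- bind a variable -/
  | letIn (x : ℕ) (a : Ex) (p : WordProg)

namespace Ex

/-- The value of an expression. -/
def eval (w : List Bool) : Ex → (ℕ → ℕ) → ℕ
  | var x, env => env x
  | const c, _ => c
  | len, _ => w.length
  | add a b, env => a.eval w env + b.eval w env
  | mul a b, env => a.eval w env * b.eval w env
  | eq a b, env => if a.eval w env = b.eval w env then 1 else 0
  | lt a b, env => if a.eval w env < b.eval w env then 1 else 0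
  | bit a, env => (w[a.eval w env]?.getD false).toNat
  | find x a φ, env => leastBelow (fun i => φ.eval w (Function.update env x i)) (a.eval w env)

/-- The exponent of a polynomial bound for all values that occur in the evaluation. -/
def cost : Ex → ℕ
  | var _ => 1
  | const c => c + 1
  | len => 1
  | add a b => a.cost + b.cost + 1
  | mul a b => a.cost + b.cost
  | eq a b => a.cost + b.cost
  | lt a b => a.cost + b.cost
  | bit a => a.cost
  | find _ a φ => a.cost * (φ.cost + 1)

theorem cost_pos (e : Ex) : 1 ≤ e.cost := by
  induction e with
  | find x a φ iha ihφ => exact Nat.mul_pos iha (Nat.succ_pos _)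
  | _ => simp only [cost] at *; omega

/-- The assumption `2 ≤ b` lets exponents absorb constants: a sum is at most twice the larger bound,
and `c < 2 ^ c ≤ b ^ c`. The value of `find` needs only the exponent of its bound; the factor
`φ.cost + 1` pays for the body, whose environment may contain values up to `b ^ a.cost`. -/
theorem eval_le {w : List Bool} {b : ℕ} (hb : 2 ≤ b) (hw : w.length ≤ b) (e : Ex) {env : ℕ → ℕ}
    (henv : ∀ x, env x ≤ b) : e.eval w env ≤ b ^ e.cost := by
  have hpow : ∀ {m n : ℕ}, m ≤ n → b ^ m ≤ b ^ n := fun h => Nat.pow_le_pow_right (by omega) h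
  have hone : ∀ n, 1 ≤ b ^ n := fun n => Nat.one_le_pow _ _ (by omega)
  induction e with
  | var x => simpa [eval, cost] using henv x
  | const c =>
    have h1 : c < 2 ^ c := Nat.lt_two_pow_self
    have h2 : 2 ^ c ≤ b ^ c := Nat.pow_le_pow_left hb c
    have h3 := hpow (Nat.le_succ c)
    simp only [eval, cost]
    exact (h1.le.trans h2).trans h3
  | len => simpa [eval, cost] using hw
  | add a b' iha ihb =>
    simp only [eval, cost]
    have h1 := hpow (Nat.le_add_right a.cost b'.cost)
    have h2 := hpow (Nat.le_add_left b'.cost a.cost)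
    calc _ ≤ b ^ (a.cost + b'.cost) * 2 := by omega
      _ ≤ b ^ (a.cost + b'.cost) * b := Nat.mul_le_mul_left _ hb
      _ = _ := (pow_succ _ _).symm
  | mul a b' iha ihb =>
    simp only [eval, cost, pow_add]
    exact Nat.mul_le_mul iha ihb
  | eq a b' _ _ =>
    simp only [eval]
    split_ifs
    · exact hone _
    · exact Nat.zero_le _
  | lt a b' _ _ =>
    simp only [eval]
    split_ifs
    · exact hone _
    · exact Nat.zero_le _
  | bit a _ =>
    simp only [eval]
    exact (Bool.toNat_le _).trans (hone _)
  | find x a φ iha _ =>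
    simp only [eval, cost]
    exact (leastBelow_le _ _).trans (iha.trans (hpow (Nat.le_mul_of_pos_right _ (by omega))))

/-- The number of registers that are used. -/
def width : Ex → ℕ
  | var _ => 1
  | const _ => 1
  | len => 1
  | add a b => a.width + b.width + 3
  | mul a b => a.width + b.width + 5
  | eq a b => a.width + b.width + 3
  | lt a b => a.width + b.width + 4
  | bit a => a.width + 3
  | find _ a φ => a.width + φ.width + 5

end Ex

/-- The registers below `v` and the output are the same. -/
def Keeps (v : ℕ) (s s' : RegState) : Prop := (∀ i < v, s'.reg i = s.reg i) ∧ s'.out = s.out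

theorem Keeps.refl (v : ℕ) (s : RegState) : Keeps v s s := ⟨fun _ _ => rfl, rfl⟩

theorem Keeps.trans {u v : ℕ} {s s' s'' : RegState} (h : Keeps v s s') (h' : Keeps u s' s'')
    (hvu : v ≤ u) : Keeps v s s'' :=
  ⟨fun i hi => (h'.1 i (by omega)).trans (h.1 i hi), h'.2.trans h.2⟩

theorem Keeps.mono {u v : ℕ} {s s' : RegState} (h : Keeps u s s') (hvu : v ≤ u) : Keeps v s s' :=
  ⟨fun i hi => h.1 i (by omega), h.2⟩

theorem Keeps.set {v r : ℕ} {s s' : RegState} (h : Keeps v s s') (hr : v ≤ r) (x : ℕ) :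
    Keeps v s (s'.set r x) :=
  ⟨fun i hi => by rw [RegState.set_reg_of_ne _ _ (by omega), h.1 i hi], h.2⟩

theorem Keeps.env {v : ℕ} {s s' : RegState} (h : Keeps v s s') {ρ : ℕ → ℕ} (hρ : ∀ x, ρ x < v) :
    (fun x => s'.reg (ρ x)) = fun x => s.reg (ρ x) :=
  funext fun x => h.1 _ (hρ x)

/-! ### Arithmetic and bounded search on registers -/

namespace Frag

variable {K : ℕ} {w : List Bool} {L : ℕ} {s : RegState} {v : ℕ}

/-- The fragment computes `x` in register `v` and keeps all registers below. -/
def Computes (F : Frag K) (w : List Bool) (L : ℕ) (s : RegState) (v x : ℕ) : Prop :=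
  F.WP w L s fun s' => s'.reg v = x ∧ Keeps v s s'

/-- Copy register `r` to register `v`. -/
theorem computes_copy {r : ℕ} (hv : v < K) (hr : r < v) (hlt : s.reg r < 2 ^ L) :
    (forLoop v r skip : Frag K).Computes w L s v (s.reg r) := by
  refine (wp_forLoop hv (by omega) (by omega) rfl hlt (fun _ t => Keeps v s t) ?_ ?_).mono ?_
  · exact (Keeps.refl v s).set le_rfl 0
  · intro k _ t h1 h2 h3
    exact wp_skip ⟨h1, h2, h3.set le_rfl _⟩
  · rintro t ⟨h1, -, h3⟩
    exact ⟨h1, h3⟩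

/-- Increase register `v` by `c`. -/
def addConst (v : ℕ) : ℕ → Frag K
  | 0 => skip
  | c + 1 => (addConst v c).seq (inc v)

theorem wp_addConst (hv : v < K) (c : ℕ) (hlt : s.reg v + c < 2 ^ L) :
    (addConst v c : Frag K).WP w L s fun t => t.reg v = s.reg v + c ∧ Keeps v s t := by
  induction c with
  | zero => exact wp_skip ⟨rfl, Keeps.refl v s⟩
  | succ c ih =>
    refine WP.seq (ih (by omega)) ?_
    rintro t ⟨h1, h2⟩
    refine wp_inc hv (by omega) ⟨?_, h2.set le_rfl _⟩
    rw [RegState.set_reg_self, h1, add_assoc]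

/-- Set register `v` to `c`. -/
def setConst (v c : ℕ) : Frag K := (clear v).seq (addConst v c)

theorem computes_setConst (hv : v < K) {c : ℕ} (hlt : c < 2 ^ L) :
    (setConst v c : Frag K).Computes w L s v c := by
  refine WP.seq (wp_clear (Q := fun t => t = s.set v 0) hv rfl) ?_
  rintro _ rfl
  refine (wp_addConst hv c (by simpa using hlt)).mono ?_
  rintro t ⟨h1, h2⟩
  exact ⟨by simpa using h1, ((Keeps.refl v s).set le_rfl 0).trans h2 le_rfl⟩

/-- Add register `n` to register `v`, with the help of register `i`. -/
theorem wp_addLoop {i n : ℕ} (hi : i < K) (hvn : v < n) (hni : n < i)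
    (hlt : s.reg v + s.reg n < 2 ^ L) :
    (forLoop i n (inc v) : Frag K).WP w L s fun t =>
      t.reg v = s.reg v + s.reg n ∧ Keeps v s t ∧ ∀ j, v < j → j ≠ i → t.reg j = s.reg j := by
  refine (wp_forLoop hi (by omega) (by omega) rfl (by omega) (fun k t => t.reg v = s.reg v + k ∧
    Keeps v s t ∧ ∀ j, v < j → j ≠ i → t.reg j = s.reg j) ?_ ?_).mono ?_
  · refine ⟨RegState.set_reg_of_ne _ _ (by omega), (Keeps.refl v s).set (by omega) 0, ?_⟩
    intro j _ hj
    exact RegState.set_reg_of_ne _ _ hj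
  · rintro k hk t h1 h2 ⟨h3, h4, h5⟩
    refine wp_inc (by omega) (by omega) ⟨?_, ?_, ?_, ?_, ?_⟩
    · rw [RegState.set_reg_of_ne _ _ (by omega), h1]
    · rw [RegState.set_reg_of_ne _ _ (by omega), h2]
    · rw [RegState.set_reg_of_ne _ _ (by omega), RegState.set_reg_self, h3, add_assoc]
    · exact (h4.set le_rfl _).set (by omega) _
    · intro j hvj hj
      rw [RegState.set_reg_of_ne _ _ hj, RegState.set_reg_of_ne _ _ (by omega), h5 j hvj hj]
  · rintro t ⟨-, -, h⟩
    exact h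

/-- Multiply the registers `v + 1` and `v + 2`. -/
def mulRegs (v : ℕ) : Frag K :=
  (clear v).seq (forLoop (v + 3) (v + 1) (forLoop (v + 4) (v + 2) (inc v)))

theorem computes_mulRegs (hv : v + 5 ≤ K) (h1 : s.reg (v + 1) < 2 ^ L)
    (hlt : s.reg (v + 1) * s.reg (v + 2) < 2 ^ L) :
    (mulRegs v : Frag K).Computes w L s v (s.reg (v + 1) * s.reg (v + 2)) := by
  refine WP.seq (wp_clear (Q := fun t => t = s.set v 0) (by omega) rfl) ?_
  rintro _ rfl
  refine (wp_forLoop (by omega) (by omega) (by omega) (RegState.set_reg_of_ne s _ (by omega)) h1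
    (fun k t => t.reg v = k * s.reg (v + 2) ∧ Keeps v s t ∧ t.reg (v + 2) = s.reg (v + 2))
      ?_ ?_).mono ?_
  · refine ⟨?_, ((Keeps.refl v s).set le_rfl _).set (by omega) _, ?_⟩
    · rw [RegState.set_reg_of_ne _ _ (by omega), RegState.set_reg_self, zero_mul]
    · rw [RegState.set_reg_of_ne _ _ (by omega), RegState.set_reg_of_ne _ _ (by omega)]
  · rintro k hk t h2 h3 ⟨h4, h5, h6⟩
    -- Partial products stay below the final product, so the counter never overflows.
    have hle : (k + 1) * s.reg (v + 2) ≤ s.reg (v + 1) * s.reg (v + 2) :=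
      Nat.mul_le_mul_right _ hk
    rw [add_mul, one_mul] at hle
    refine (wp_addLoop (v := v) (n := v + 2) (by omega) (by omega) (by omega)
      (by rw [h4, h6]; omega)).mono ?_
    rintro t' ⟨h7, h8, h9⟩
    refine ⟨?_, ?_, ?_, ?_, ?_⟩
    · rw [h9 _ (by omega) (by omega), h2]
    · rw [h9 _ (by omega) (by omega), h3]
    · rw [RegState.set_reg_of_ne _ _ (by omega), h7, h4, h6, add_mul, one_mul]
    · exact (h5.trans h8 le_rfl).set (by omega) _
    · rw [RegState.set_reg_of_ne _ _ (by omega), h9 _ (by omega) (by omega), h6]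
  · rintro t ⟨-, -, h, h', -⟩
    exact ⟨h, h'⟩

/-- Compare the registers `v + 1` and `v + 2`. -/
def eqRegs (v : ℕ) : Frag K := ifEq (v + 1) (v + 2) (setConst v 1) (setConst v 0)

theorem computes_eqRegs (hv : v + 3 ≤ K) (hL : 1 < 2 ^ L) :
    (eqRegs v : Frag K).Computes w L s v (if s.reg (v + 1) = s.reg (v + 2) then 1 else 0) := by
  refine wp_ifEq (by omega) (by omega) (by omega) (fun h => ?_) (fun h => ?_)
  · rw [if_pos h]
    exact computes_setConst (by omega) hL
  · rw [if_neg h]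
    exact computes_setConst (by omega) (by omega)

/-- Is register `v + 1` less than register `v + 2`? -/
def ltRegs (v : ℕ) : Frag K :=
  (clear v).seq (forLoop (v + 3) (v + 2) (ifEq (v + 3) (v + 1) (setConst v 1) skip))

/-- A number is less than the bound of a loop exactly if it occurs among the loop indices. -/
theorem computes_ltRegs (hv : v + 4 ≤ K) (hL : 1 < 2 ^ L) (h2 : s.reg (v + 2) < 2 ^ L) :
    (ltRegs v : Frag K).Computes w L s v (if s.reg (v + 1) < s.reg (v + 2) then 1 else 0) := by
  refine WP.seq (wp_clear (Q := fun t => t = s.set v 0) (by omega) rfl) ?_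
  rintro _ rfl
  refine (wp_forLoop (by omega) (by omega) (by omega) (RegState.set_reg_of_ne s _ (by omega)) h2
    (fun k t => t.reg v = (if s.reg (v + 1) < k then 1 else 0) ∧ Keeps v s t ∧
      t.reg (v + 1) = s.reg (v + 1)) ?_ ?_).mono ?_
  · refine ⟨?_, ((Keeps.refl v s).set le_rfl _).set (by omega) _, ?_⟩
    · rw [RegState.set_reg_of_ne _ _ (by omega), RegState.set_reg_self, if_neg (by omega)]
    · rw [RegState.set_reg_of_ne _ _ (by omega), RegState.set_reg_of_ne _ _ (by omega)]
  · rintro k hk t h3 h4 ⟨h5, h6, h7⟩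
    refine wp_ifEq (by omega) (by omega) (by omega) (fun h => ?_) (fun h => ?_)
    -- `setConst v 1` is executed instruction by instruction here: `computes_setConst` says nothing
    -- about the registers above `v`, which hold the operands and the loop index.
    · refine WP.seq (wp_clear (Q := fun t' => t' = t.set v 0) (by omega) rfl) ?_
      rintro _ rfl
      refine WP.seq (wp_skip (Q := fun t' => t' = t.set v 0) rfl) ?_
      rintro _ rfl
      refine wp_inc (by omega) (by simpa using hL) ⟨?_, ?_, ?_, ?_, ?_⟩
      · simpa [RegState.set] using h3
      · simpa [RegState.set] using h4
      · rw [RegState.set_reg_of_ne _ _ (by omega), if_pos (by omega)]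
        simp
      · exact ((h6.set le_rfl _).set le_rfl _).set (by omega) _
      · simpa [RegState.set] using h7
    · refine wp_skip ⟨h3, h4, ?_, h6.set (by omega) _, ?_⟩
      · rw [RegState.set_reg_of_ne _ _ (by omega), h5]
        have : s.reg (v + 1) < k ↔ s.reg (v + 1) < k + 1 := by omega
        simp only [this]
      · rw [RegState.set_reg_of_ne _ _ (by omega), h7]
  · rintro t ⟨-, -, h, h', -⟩
    exact ⟨h, h'⟩

/-- The bit of the input whose index is in register `v + 1`. -/
def bitReg (v : ℕ) : Frag K :=
  (seek (v + 2) (v + 1)).seq (ifInput isOne (setConst v 1) (setConst v 0))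

theorem computes_bitReg (hv : v + 3 ≤ K) (hL : 1 < 2 ^ L) (h1 : s.reg (v + 1) < 2 ^ L) :
    (bitReg v : Frag K).Computes w L s v (w[s.reg (v + 1)]?.getD false).toNat := by
  refine WP.seq (wp_seek (Q := fun t => Keeps v s t ∧
    t.pos = min (s.reg (v + 1) + 1) (w.length + 1)) (by omega) (by omega) (by omega) h1
    ⟨(Keeps.refl v s).set (by omega) _, rfl⟩) ?_
  rintro t ⟨h2, h3⟩
  have hcell : isOne (inputCell w t.pos) = (w[s.reg (v + 1)]?.getD false) := by
    rw [h3]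
    -- For an index beyond the word the scanned cell is the right end marker. It counts as `0`, in
    -- agreement with the default value `false`.
    rcases le_total (s.reg (v + 1)) w.length with h | h
    · rw [min_eq_left (by omega), isOne_inputCell]
    · rw [min_eq_right (by omega), isOne_inputCell, List.getElem?_eq_none le_rfl,
        List.getElem?_eq_none h]
  refine wp_ifInput (fun h => ?_) (fun h => ?_)
  · refine (computes_setConst (v := v) (by omega) hL).mono ?_
    rintro t' ⟨h4, h5⟩
    rw [← hcell, h]
    exact ⟨h4, h2.trans h5 le_rfl⟩
  · refine (computes_setConst (v := v) (c := 0) (by omega) (by omega)).mono ?_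
    rintro t' ⟨h4, h5⟩
    rw [← hcell, h]
    exact ⟨h4, h2.trans h5 le_rfl⟩

/-- The least index below the content of register `v + 1` for which the fragment `F` computes a
value other than `0` in register `v + 3`; the index is in register `v + 2`. -/
def findReg (v : ℕ) (F : Frag K) : Frag K :=
  (clear v).seq (forLoop (v + 2) (v + 1)
    (ifEq v (v + 2) (F.seq ((clear (v + 4)).seq (ifEq (v + 3) (v + 4) (inc v) skip))) skip))

/-- Register `v` equals the loop index exactly as long as the search has had no success, so `F` runs
only while the two agree. The assumption on `F` covers all states with the registers below `v`
unchanged, since `F` is restarted on whatever earlier rounds left above. -/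
theorem computes_findReg {F : Frag K} {f : ℕ → ℕ} (hv : v + 5 ≤ K) (h1 : s.reg (v + 1) < 2 ^ L)
    (hF : ∀ t, Keeps v s t → t.reg (v + 2) < s.reg (v + 1) →
      F.Computes w L t (v + 3) (f (t.reg (v + 2)))) :
    (findReg v F).Computes w L s v (leastBelow f (s.reg (v + 1))) := by
  refine WP.seq (wp_clear (Q := fun t => t = s.set v 0) (by omega) rfl) ?_
  rintro _ rfl
  refine (wp_forLoop (by omega) (by omega) (by omega) (RegState.set_reg_of_ne s _ (by omega)) h1
    (fun k t => t.reg v = leastBelow f k ∧ Keeps v s t) ?_ ?_).mono ?_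
  · refine ⟨?_, ((Keeps.refl v s).set le_rfl _).set (by omega) _⟩
    rw [RegState.set_reg_of_ne _ _ (by omega), RegState.set_reg_self, leastBelow]
  · rintro k hk t h2 h3 ⟨h4, h5⟩
    refine wp_ifEq (by omega) (by omega) (by omega) (fun h => ?_) (fun h => ?_)
    · refine WP.seq (hF t h5 (by omega)) ?_
      rintro t₁ ⟨h6, h7⟩
      refine WP.seq (wp_clear (Q := fun t' => t' = t₁.set (v + 4) 0) (by omega) rfl) ?_
      rintro _ rfl
      have k0 : (t₁.set (v + 4) 0).reg v = leastBelow f k := by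
        rw [RegState.set_reg_of_ne _ _ (by omega), h7.1 v (by omega), h4]
      have k1 : (t₁.set (v + 4) 0).reg (v + 1) = s.reg (v + 1) := by
        rw [RegState.set_reg_of_ne _ _ (by omega), h7.1 _ (by omega), h3]
      have k2 : (t₁.set (v + 4) 0).reg (v + 2) = k := by
        rw [RegState.set_reg_of_ne _ _ (by omega), h7.1 _ (by omega), h2]
      have k3 : (t₁.set (v + 4) 0).reg (v + 3) = f k := by
        rw [RegState.set_reg_of_ne _ _ (by omega), h6, h2]
      have kk : Keeps v s (t₁.set (v + 4) 0) :=
        (h5.trans h7 (by omega)).set (by omega) _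
      refine wp_ifEq (by omega) (by omega) (by omega) (fun h' => ?_) (fun h' => ?_)
      · rw [k3, RegState.set_reg_self] at h'
        refine wp_inc (by omega) (by omega) ⟨?_, ?_, ?_, (kk.set le_rfl _).set (by omega) _⟩
        · rw [RegState.set_reg_of_ne _ _ (by omega), k2]
        · rw [RegState.set_reg_of_ne _ _ (by omega), k1]
        · rw [RegState.set_reg_of_ne _ _ (by omega), RegState.set_reg_self, k0, leastBelow,
            if_pos ⟨by omega, h'⟩]
          omega
      · rw [k3, RegState.set_reg_self] at h'
        refine wp_skip ⟨k2, k1, ?_, kk.set (by omega) _⟩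
        rw [RegState.set_reg_of_ne _ _ (by omega), k0, leastBelow, if_neg fun hc => h' hc.2]
    · refine wp_skip ⟨h2, h3, ?_, h5.set (by omega) _⟩
      rw [RegState.set_reg_of_ne _ _ (by omega), h4, leastBelow, if_neg fun hc => by omega]
  · rintro t ⟨-, -, h, h'⟩
    exact ⟨h, h'⟩

end Frag

/-! ### Binding a variable to a fresh register -/

section Update

variable {ρ : ℕ → ℕ} {v : ℕ} {s t : RegState}

theorem update_env (hρ : ∀ x, ρ x < v) (h : ∀ i < v, t.reg i = s.reg i) {x r : ℕ} :
    (fun y => t.reg (Function.update ρ x r y)) =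
      Function.update (fun x => s.reg (ρ x)) x (t.reg r) := by
  funext y
  rcases eq_or_ne y x with rfl | hy
  · simp
  · simp only [Function.update_of_ne hy]
    exact h _ (hρ y)

theorem update_lt (hρ : ∀ x, ρ x < v) {x r u : ℕ} (hr : r < u) (hu : v ≤ u) (y : ℕ) :
    Function.update ρ x r y < u := by
  rcases eq_or_ne y x with rfl | hy
  · simpa using hr
  · rw [Function.update_of_ne hy]
    exact (hρ y).trans_le hu

theorem update_le (hρ : ∀ x, ρ x < v) {b c : ℕ} (hs : ∀ x, s.reg (ρ x) ≤ b)
    (h : ∀ i < v, t.reg i = s.reg i) (hbc : b ≤ c) {x r : ℕ} (hr : t.reg r ≤ c) (y : ℕ) :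
    t.reg (Function.update ρ x r y) ≤ c := by
  rcases eq_or_ne y x with rfl | hy
  · simpa using hr
  · rw [Function.update_of_ne hy, h _ (hρ y)]
    exact (hs y).trans hbc

end Update

/-! ### Compilation of expressions -/

namespace Ex

variable {K : ℕ} {w : List Bool} {L : ℕ}

/-- The fragment that evaluates an expression: the variable `x` is in register `ρ x`, the result
goes to register `v`, and the registers above `v` are for auxiliary values. -/
def code (K : ℕ) : Ex → (ℕ → ℕ) → ℕ → Frag K
  | var x, ρ, v => .forLoop v (ρ x) .skip
  | const c, _, v => .setConst v c
  | len, _, v => .readLength v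
  | add a b, ρ, v => (a.code K ρ v).seq
      ((b.code K ρ (v + 1)).seq (.forLoop (v + 2) (v + 1) (.inc v)))
  | mul a b, ρ, v => (a.code K ρ (v + 1)).seq ((b.code K ρ (v + 2)).seq (.mulRegs v))
  | eq a b, ρ, v => (a.code K ρ (v + 1)).seq ((b.code K ρ (v + 2)).seq (.eqRegs v))
  | lt a b, ρ, v => (a.code K ρ (v + 1)).seq ((b.code K ρ (v + 2)).seq (.ltRegs v))
  | bit a, ρ, v => (a.code K ρ (v + 1)).seq (.bitReg v)
  | find x a φ, ρ, v => (a.code K ρ (v + 1)).seq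
      (.findReg v (φ.code K (Function.update ρ x (v + 2)) (v + 3)))

/-- The code of an expression is correct. -/
def Correct (K : ℕ) (w : List Bool) (L : ℕ) (e : Ex) : Prop :=
  ∀ ⦃ρ : ℕ → ℕ⦄ ⦃v b : ℕ⦄ ⦃s : RegState⦄, (∀ x, ρ x < v) → v + e.width ≤ K → 2 ≤ b →
    w.length ≤ b → (∀ x, s.reg (ρ x) ≤ b) → b ^ e.cost < 2 ^ L →
    (e.code K ρ v).Computes w L s v (e.eval w fun x => s.reg (ρ x))

/-- Evaluation of two expressions into the registers `u` and `u + 1`. -/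
theorem Correct.pair {a c : Ex} (ha : Correct K w L a) (hc : Correct K w L c) {F : Frag K}
    {ρ : ℕ → ℕ} {u v b z : ℕ} {s : RegState} (hρ : ∀ x, ρ x < v) (hvu : v ≤ u)
    (hK : u + (a.width + c.width + 1) ≤ K) (hb : 2 ≤ b) (hw : w.length ≤ b)
    (hs : ∀ x, s.reg (ρ x) ≤ b) (hL : b ^ (a.cost + c.cost) < 2 ^ L)
    (hF : ∀ t, t.reg u = (a.eval w fun x => s.reg (ρ x)) →
      t.reg (u + 1) = (c.eval w fun x => s.reg (ρ x)) →
      t.reg u < 2 ^ L → t.reg (u + 1) < 2 ^ L → F.Computes w L t v z) :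
    ((a.code K ρ u).seq ((c.code K ρ (u + 1)).seq F)).Computes w L s v z := by
  have haL : b ^ a.cost < 2 ^ L := (Nat.pow_le_pow_right (by omega) (by omega)).trans_lt hL
  have hcL : b ^ c.cost < 2 ^ L := (Nat.pow_le_pow_right (by omega) (by omega)).trans_lt hL
  refine Frag.WP.seq (ha (fun x => (hρ x).trans_le hvu) (by omega) hb hw hs haL) ?_
  rintro t ⟨h1, h2⟩
  have henv := h2.env fun x => (hρ x).trans_le hvu
  have hs' : ∀ x, t.reg (ρ x) ≤ b := fun x => (congrFun henv x).trans_le (hs x)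
  have hcode := hc (v := u + 1) (fun x => (hρ x).trans_le (by omega)) (by omega) hb hw hs' hcL
  rw [henv] at hcode
  refine Frag.WP.seq hcode ?_
  rintro t' ⟨h3, h4⟩
  have h5 : t'.reg u = a.eval w fun x => s.reg (ρ x) := (h4.1 u (by omega)).trans h1
  refine (hF t' h5 h3 ?_ ?_).mono ?_
  · rw [h5]
    exact (eval_le hb hw a hs).trans_lt haL
  · rw [h3]
    exact (eval_le hb hw c hs).trans_lt hcL
  · rintro t'' ⟨h6, h7⟩
    exact ⟨h6, ((h2.mono hvu).trans h4 (by omega)).trans h7 le_rfl⟩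

theorem correct (K : ℕ) (w : List Bool) (L : ℕ) (e : Ex) : Correct K w L e := by
  induction e with
  | var x =>
    intro ρ v b s hρ hK hb hw hs hL
    exact Frag.computes_copy (by simp [width] at hK; omega) (hρ x)
      ((eval_le hb hw (var x) hs).trans_lt hL)
  | const c =>
    intro ρ v b s hρ hK hb hw hs hL
    exact Frag.computes_setConst (by simp [width] at hK; omega)
      ((eval_le hb hw (const c) hs).trans_lt hL)
  | len =>
    intro ρ v b s hρ hK hb hw hs hL
    refine Frag.wp_readLength (by simp [width] at hK; omega)
      ((eval_le hb hw len hs).trans_lt hL) ⟨?_, ?_⟩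
    · simp [eval]
    · exact (Keeps.refl v s).set le_rfl _
  | add a c iha ihc =>
    intro ρ v b s hρ hK hb hw hs hL
    have hlt := (eval_le hb hw (add a c) hs).trans_lt hL
    simp only [width, cost] at hK hL
    refine iha.pair ihc hρ le_rfl (by omega) hb hw hs
      ((Nat.pow_le_pow_right (by omega) (by omega)).trans_lt hL) fun t h1 h2 _ _ => ?_
    refine (Frag.wp_addLoop (by omega) (by omega) (by omega) (by rw [h1, h2]; exact hlt)).mono ?_
    rintro t' ⟨h3, h4, -⟩
    exact ⟨by rw [h3, h1, h2]; rfl, h4⟩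
  | mul a c iha ihc =>
    intro ρ v b s hρ hK hb hw hs hL
    have hlt := (eval_le hb hw (mul a c) hs).trans_lt hL
    simp only [width, cost] at hK hL
    refine iha.pair ihc hρ (Nat.le_succ v) (by omega) hb hw hs hL fun t h1 h2 h3 _ => ?_
    have := Frag.computes_mulRegs (w := w) (K := K) (by omega) h3 (by rw [h1, h2]; exact hlt)
    rwa [h1, h2] at this
  | eq a c iha ihc =>
    intro ρ v b s hρ hK hb hw hs hL
    simp only [width, cost] at hK hL
    refine iha.pair ihc hρ (Nat.le_succ v) (by omega) hb hw hs hL fun t h1 h2 _ _ => ?_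
    have := Frag.computes_eqRegs (w := w) (K := K) (v := v) (s := t) (L := L) (by omega)
      (lt_of_le_of_lt (Nat.one_le_pow _ _ (by omega)) hL)
    rwa [h1, h2] at this
  | lt a c iha ihc =>
    intro ρ v b s hρ hK hb hw hs hL
    simp only [width, cost] at hK hL
    refine iha.pair ihc hρ (Nat.le_succ v) (by omega) hb hw hs hL fun t h1 h2 _ h4 => ?_
    have := Frag.computes_ltRegs (w := w) (K := K) (by omega)
      (lt_of_le_of_lt (Nat.one_le_pow _ _ (by omega)) hL) h4
    rwa [h1, h2] at this
  | bit a iha =>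
    intro ρ v b s hρ hK hb hw hs hL
    simp only [width, cost] at hK hL
    refine Frag.WP.seq (iha (v := v + 1) (fun x => (hρ x).trans (Nat.lt_succ_self v)) (by omega)
      hb hw hs hL) ?_
    rintro t ⟨h1, h2⟩
    have := Frag.computes_bitReg (w := w) (K := K) (v := v) (s := t) (L := L) (by omega)
      (lt_of_le_of_lt (Nat.one_le_pow _ _ (by omega)) hL)
      (by rw [h1]; exact (eval_le hb hw a hs).trans_lt hL)
    rw [h1] at this
    refine this.mono ?_
    rintro t' ⟨h3, h4⟩
    exact ⟨h3, (h2.mono (Nat.le_succ v)).trans h4 le_rfl⟩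
  | find x a φ iha ihφ =>
    intro ρ v b s hρ hK hb hw hs hL
    simp only [width, cost] at hK hL
    have ha : b ^ a.cost < 2 ^ L := (Nat.pow_le_pow_right (by omega)
      (Nat.le_mul_of_pos_right _ (Nat.succ_pos _))).trans_lt hL
    have hea := eval_le hb hw a hs
    refine Frag.WP.seq (iha (v := v + 1) (fun x => (hρ x).trans (Nat.lt_succ_self v)) (by omega)
      hb hw hs ha) ?_
    rintro t ⟨h1, h2⟩
    have hbb : b ≤ b ^ a.cost := Nat.le_self_pow (by have := a.cost_pos; omega) b
    have key := Frag.computes_findReg (w := w) (K := K) (v := v) (s := t) (L := L)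
      (F := φ.code K (Function.update ρ x (v + 2)) (v + 3))
      (f := fun i => φ.eval w (Function.update (fun x => s.reg (ρ x)) x i)) (by omega)
      (by rw [h1]; exact hea.trans_lt ha) ?_
    · rw [h1] at key
      refine key.mono ?_
      rintro t' ⟨h3, h4⟩
      exact ⟨h3, (h2.mono (Nat.le_succ v)).trans h4 le_rfl⟩
    · intro t₁ h3 h4
      rw [h1] at h4
      have hst := (h2.mono (Nat.le_succ v)).trans h3 le_rfl
      -- The bound variable can be as large as the value of `a`, so the induction hypothesis is used
      -- with `b ^ a.cost` in place of `b`; this is why exponents multiply in the cost of `find`.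
      have := ihφ (ρ := Function.update ρ x (v + 2)) (v := v + 3) (b := b ^ a.cost) (s := t₁)
        (update_lt hρ (by omega) (by omega))
        (by omega) (hb.trans hbb) (hw.trans hbb)
        (update_le hρ hs hst.1 hbb (h4.le.trans hea)) (by
          rw [← pow_mul]
          exact (Nat.pow_le_pow_right (by omega)
            (Nat.mul_le_mul_left _ (Nat.le_succ _))).trans_lt hL)
      rwa [update_env hρ hst.1] at this

end Ex

/-! ### Compilation of word programs -/

namespace WordProg

variable {K : ℕ} {w : List Bool} {L : ℕ}

/-- The word that is written. -/
def eval (w : List Bool) : WordProg → (ℕ → ℕ) → List Bool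
  | nil, _ => []
  | emit b, _ => [b]
  | seq p q, env => p.eval w env ++ q.eval w env
  | ite φ p q, env => if φ.eval w env = 0 then q.eval w env else p.eval w env
  | loop x a p, env =>
      (List.range (a.eval w env)).flatMap fun i => p.eval w (Function.update env x i)
  | letIn x a p, env => p.eval w (Function.update env x (a.eval w env))

/-- The exponent of a polynomial bound for all values that occur in the evaluation. -/
def cost : WordProg → ℕ
  | nil => 1
  | emit _ => 1
  | seq p q => p.cost + q.cost
  | ite φ p q => φ.cost + p.cost + q.cost
  | loop _ a p => a.cost * (p.cost + 1)
  | letIn _ a p => a.cost * (p.cost + 1)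

/-- The number of registers that are used. -/
def width : WordProg → ℕ
  | nil => 0
  | emit _ => 0
  | seq p q => p.width + q.width
  | ite φ p q => φ.width + p.width + q.width + 2
  | loop _ a p => a.width + p.width + 2
  | letIn _ a p => a.width + p.width + 1

/-- The fragment that executes a program. -/
def code (K : ℕ) : WordProg → (ℕ → ℕ) → ℕ → Frag K
  | nil, _, _ => .skip
  | emit b, _, _ => .emit b
  | seq p q, ρ, v => (p.code K ρ v).seq (q.code K ρ v)
  | ite φ p q, ρ, v => (φ.code K ρ v).seq ((Frag.clear (v + 1)).seq
      (.ifEq v (v + 1) (q.code K ρ v) (p.code K ρ v)))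
  | loop x a p, ρ, v => (a.code K ρ v).seq
      (.forLoop (v + 1) v (p.code K (Function.update ρ x (v + 1)) (v + 2)))
  | letIn x a p, ρ, v => (a.code K ρ v).seq (p.code K (Function.update ρ x v) (v + 1))

theorem wp_code (p : WordProg) {ρ : ℕ → ℕ} {v b : ℕ} {s : RegState} (hρ : ∀ x, ρ x < v)
    (hK : v + p.width ≤ K) (hb : 2 ≤ b) (hw : w.length ≤ b) (hs : ∀ x, s.reg (ρ x) ≤ b)
    (hL : b ^ p.cost < 2 ^ L) :
    (p.code K ρ v).WP w L s fun t =>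
      (∀ i < v, t.reg i = s.reg i) ∧ t.out = s.out ++ p.eval w fun x => s.reg (ρ x) := by
  induction p generalizing ρ v b s with
  | nil => exact Frag.wp_skip ⟨fun _ _ => rfl, by simp [eval]⟩
  | emit c => exact Frag.wp_emit c ⟨fun _ _ => rfl, rfl⟩
  | seq p q ihp ihq =>
    simp only [width, cost] at hK hL
    refine Frag.WP.seq (ihp hρ (by omega) hb hw hs
      ((Nat.pow_le_pow_right (by omega) (by omega)).trans_lt hL)) ?_
    rintro t ⟨h1, h2⟩
    have henv : (fun x => t.reg (ρ x)) = fun x => s.reg (ρ x) := funext fun x => h1 _ (hρ x)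
    refine (ihq (s := t) hρ (by omega) hb hw (fun x => (congrFun henv x).trans_le (hs x))
      ((Nat.pow_le_pow_right (by omega) (by omega)).trans_lt hL)).mono ?_
    rintro t' ⟨h3, h4⟩
    refine ⟨fun i hi => (h3 i hi).trans (h1 i hi), ?_⟩
    rw [h4, h2, henv, List.append_assoc]
    rfl
  | ite φ p q ihp ihq =>
    simp only [width, cost] at hK hL
    refine Frag.WP.seq (φ.correct K w L hρ (by omega) hb hw hs
      ((Nat.pow_le_pow_right (by omega) (by omega)).trans_lt hL)) ?_
    rintro t₁ ⟨h1, h2⟩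
    refine Frag.WP.seq (Frag.wp_clear (Q := fun t => t = t₁.set (v + 1) 0) (by omega) rfl) ?_
    rintro t rfl
    have hk := h2.set (Nat.le_succ v) 0
    have hv : (t₁.set (v + 1) 0).reg v = φ.eval w fun x => s.reg (ρ x) := by
      rw [RegState.set_reg_of_ne _ _ (by omega), h1]
    have henv := hk.env hρ
    have hs' : ∀ x, (t₁.set (v + 1) 0).reg (ρ x) ≤ b := fun x =>
      (congrFun henv x).trans_le (hs x)
    refine Frag.wp_ifEq (by omega) (by omega) (by omega) (fun h => ?_) (fun h => ?_)
    · refine (ihq hρ (by omega) hb hw hs'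
        ((Nat.pow_le_pow_right (by omega) (by omega)).trans_lt hL)).mono ?_
      rintro t' ⟨h3, h4⟩
      refine ⟨fun i hi => (h3 i hi).trans (hk.1 i hi), ?_⟩
      rw [hv, RegState.set_reg_self] at h
      rw [h4, hk.2, henv, eval, if_pos h]
    · refine (ihp hρ (by omega) hb hw hs'
        ((Nat.pow_le_pow_right (by omega) (by omega)).trans_lt hL)).mono ?_
      rintro t' ⟨h3, h4⟩
      refine ⟨fun i hi => (h3 i hi).trans (hk.1 i hi), ?_⟩
      rw [hv, RegState.set_reg_self] at h
      rw [h4, hk.2, henv, eval, if_neg h]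
  | loop x a p ih =>
    simp only [width, cost] at hK hL
    have ha : b ^ a.cost < 2 ^ L := (Nat.pow_le_pow_right (by omega)
      (Nat.le_mul_of_pos_right _ (Nat.succ_pos _))).trans_lt hL
    have hea := Ex.eval_le hb hw a hs
    have hbb : b ≤ b ^ a.cost := Nat.le_self_pow (by have := a.cost_pos; omega) b
    refine Frag.WP.seq (a.correct K w L hρ (by omega) hb hw hs ha) ?_
    rintro t₁ ⟨h1, h2⟩
    refine (Frag.wp_forLoop (by omega) (by omega) (by omega) h1 (hea.trans_lt ha)
      (fun k t => (∀ i < v, t.reg i = s.reg i) ∧ t.out = s.out ++ (List.range k).flatMap fun i =>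
        p.eval w (Function.update (fun x => s.reg (ρ x)) x i)) ?_ ?_).mono ?_
    · exact ⟨(h2.set (Nat.le_succ v) 0).1, by simp [h2.2]⟩
    · rintro k hk t h3 h4 ⟨h5, h6⟩
      -- The loop index lives in register `v + 1` and its bound in `v`, so the body starts at `v +
      -- 2`; the bound on the environment is raised as for `find`.
      refine (ih (s := t) (b := b ^ a.cost) (v := v + 2) (ρ := Function.update ρ x (v + 1))
        (update_lt hρ (by omega) (by omega)) (by omega) (hb.trans hbb) (hw.trans hbb)
        (update_le hρ hs h5 hbb (by rw [h3]; exact hk.le.trans hea)) ?_).mono ?_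
      · rw [← pow_mul]
        exact (Nat.pow_le_pow_right (by omega)
          (Nat.mul_le_mul_left _ (Nat.le_succ _))).trans_lt hL
      · rintro t' ⟨h7, h8⟩
        refine ⟨(h7 _ (by omega)).trans h3, (h7 _ (by omega)).trans h4, fun i hi => ?_, ?_⟩
        · rw [RegState.set_reg_of_ne _ _ (by omega), h7 i (by omega), h5 i hi]
        · rw [RegState.set_out, h8, h6, update_env hρ h5, h3, List.range_succ,
            List.flatMap_append, List.append_assoc]
          simp
    · rintro t ⟨-, -, h⟩
      exact h
  | letIn x a p ih =>
    simp only [width, cost] at hK hL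
    have ha : b ^ a.cost < 2 ^ L := (Nat.pow_le_pow_right (by omega)
      (Nat.le_mul_of_pos_right _ (Nat.succ_pos _))).trans_lt hL
    have hea := Ex.eval_le hb hw a hs
    have hbb : b ≤ b ^ a.cost := Nat.le_self_pow (by have := a.cost_pos; omega) b
    refine Frag.WP.seq (a.correct K w L hρ (by omega) hb hw hs ha) ?_
    rintro t ⟨h1, h2⟩
    refine (ih (s := t) (b := b ^ a.cost) (v := v + 1) (ρ := Function.update ρ x v)
      (update_lt hρ (by omega) (by omega)) (by omega) (hb.trans hbb) (hw.trans hbb)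
      (update_le hρ hs h2.1 hbb (by rw [h1]; exact hea)) ?_).mono ?_
    · rw [← pow_mul]
      exact (Nat.pow_le_pow_right (by omega)
        (Nat.mul_le_mul_left _ (Nat.le_succ _))).trans_lt hL
    · rintro t' ⟨h3, h4⟩
      refine ⟨fun i hi => (h3 i (by omega)).trans (h2.1 i hi), ?_⟩
      rw [h4, h2.2, update_env hρ h2.1, h1]
      rfl

/-- Mark cell `0` of every work tape. -/
def initTapes : Frag K := .single .stay (fun _ _ => (true, none)) (fun _ => .stay) none

/-- Blank cells carry no flag, so cell `0` must be marked on all tapes before any head can be sent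
home. -/
theorem run_initTapes : (initTapes : Frag K).Run w (L + 1) (Frag.blankStore K)
    (counterStore 0 (fun _ => []) (fun _ => 0) []) := by
  refine Frag.run_single (fun _ => Nat.succ_pos L) ?_ (fun _ => Nat.succ_pos L)
  apply Store.ext
  · simp [Store.act, Frag.blankStore, counterStore, HeadMove.apply]
  · funext t i
    change Function.update (fun _ => (false, none)) 0 (true, none) i = counterCell [] i
    rcases i with _ | i
    · simp [counterCell]
    · simp [counterCell]
  · rfl
  · rfl

/-- The word written by a program is computed in logarithmic space. -/
theorem logspaceComputable (p : WordProg) : LogspaceComputable fun w => p.eval w fun _ => 0 := by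
  -- The extra register `0` keeps the value `0` and stands for all unbound variables.
  let K := p.width + 1
  refine ⟨((initTapes : Frag K).seq (p.code K (fun _ => 0) 1)).toTransducer,
    3 * (p.cost + 1) + 1, fun w => ?_⟩
  -- All values are bounded by a power of `b = |w| + 2`, which is at least `2` even for the empty
  -- word and less than `2 ^ (log |w| + 3)`. Then `b ^ p.cost` fits into `L` digits, and `L + 1`
  -- cells are at most `3 * (p.cost + 1) + 1` times `log |w| + 1`.
  let L := (Nat.log 2 w.length + 3) * (p.cost + 1)
  have hlog : w.length + 2 < 2 ^ (Nat.log 2 w.length + 3) := by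
    have h1 : w.length < 2 ^ (Nat.log 2 w.length + 1) := Nat.lt_pow_succ_log_self (by norm_num) _
    have h2 : 1 ≤ 2 ^ (Nat.log 2 w.length) := Nat.one_le_two_pow
    rw [pow_succ] at h1
    rw [pow_add]
    omega
  have hL : (w.length + 2) ^ p.cost < 2 ^ L := by
    rw [pow_mul]
    calc (w.length + 2) ^ p.cost ≤ (w.length + 2) ^ (p.cost + 1) :=
          Nat.pow_le_pow_right (by omega) (Nat.le_succ _)
      _ < _ := Nat.pow_lt_pow_left hlog (Nat.succ_ne_zero _)
  obtain ⟨s', d', ⟨-, hout⟩, ⟨-, ds, -, -, hd'⟩, hrun⟩ := p.wp_code (K := K) (w := w) (L := L)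
    (ρ := fun _ => 0) (v := 1) (b := w.length + 2) (s := ⟨fun _ => 0, 0, []⟩) (by simp)
    (by simp only [K]; omega) (by omega) (by omega) (by simp) hL _
    ⟨Nat.zero_le _, fun _ => [], by simp, by simp [digitsVal], rfl⟩
  have hall := run_initTapes.seq hrun
  have hd'out : d'.out = p.eval w fun _ => 0 := by
    rw [hd']
    simpa [counterStore] using hout
  have houtputs := hall.outputs
  rw [hd'out] at houtputs
  refine ⟨houtputs, fun c hc t => (hall.usesSpace c hc t).trans_le ?_⟩
  simp only [L]
  nlinarith [Nat.zero_le (Nat.log 2 w.length), Nat.zero_le p.cost,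
    Nat.zero_le (Nat.log 2 w.length * p.cost)]

end WordProg

/-! ### Words that encode graphs and groups -/

/-- The final `0` makes the unary code prefix-free, so it can be split off uniquely. -/
theorem encodeUnary_append_inj {a b : ℕ} {u v : List Bool}
    (h : encodeUnary a ++ u = encodeUnary b ++ v) : a = b ∧ u = v := by
  induction a generalizing b with
  | zero =>
    rcases b with _ | b
    · simpa [encodeUnary] using h
    · simp [encodeUnary, List.replicate_succ] at h
  | succ a ih =>
    rcases b with _ | b
    · simp [encodeUnary, List.replicate_succ] at h
    · have := ih (b := b) (by simpa [encodeUnary, List.replicate_succ] using h)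
      exact ⟨by omega, this.2⟩

/-- Unique splitting passes from blocks to concatenations of blocks over the same index list. -/
theorem flatMap_append_inj {α β : Type*} {F G : α → List β} {P : α → Prop}
    (hFG : ∀ x u v, F x ++ u = G x ++ v → P x ∧ u = v) (l : List α) {u v : List β}
    (h : l.flatMap F ++ u = l.flatMap G ++ v) : (∀ x ∈ l, P x) ∧ u = v := by
  induction l with
  | nil => exact ⟨by simp, by simpa using h⟩
  | cons x l ih =>
    simp only [List.flatMap_cons, List.append_assoc] at h
    obtain ⟨h1, h2⟩ := hFG x _ _ h
    obtain ⟨h3, h4⟩ := ih h2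
    exact ⟨by simpa using ⟨h1, h3⟩, h4⟩

/-- A yes-instance only asserts that some decoding has the property. Unique decoding up to
isomorphism transfers it to the decoding intended by the reduction. -/
theorem encode_inj {k m k' m' : ℕ} {G G' : Type} [Group G] [Group G'] {e : G ≃ Fin k}
    {e' : G' ≃ Fin k'} {X : SimpleGraph (Fin m)} {X' : SimpleGraph (Fin m')}
    (h : encodeGroup e ++ encodeGraph X = encodeGroup e' ++ encodeGraph X') :
    Nonempty (G ≃* G') ∧ Nonempty (X ≃g X') := by
  classical
  simp only [encodeGroup, List.append_assoc] at h
  obtain ⟨rfl, h⟩ := encodeUnary_append_inj h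
  obtain ⟨h1, h⟩ := flatMap_append_inj
    (P := fun i => ∀ j ∈ List.finRange k, (e (e.symm i * e.symm j)).val =
      (e' (e'.symm i * e'.symm j)).val)
    (fun i u v huv => flatMap_append_inj (fun j u v => encodeUnary_append_inj) _ huv) _ h
  constructor
  -- Equal tables mean that matching the elements by their numbers is multiplicative.
  · refine ⟨{ toEquiv := e.trans e'.symm, map_mul' := fun a b => ?_ }⟩
    have := Fin.ext (h1 (e a) (List.mem_finRange _) (e b) (List.mem_finRange _))
    rw [e.symm_apply_apply, e.symm_apply_apply] at this
    exact (e'.symm_apply_eq).2 this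
  · simp only [encodeGraph] at h
    obtain ⟨rfl, h⟩ := encodeUnary_append_inj h
    have h' := flatMap_append_inj
      (P := fun i => ∀ j ∈ List.finRange m, decide (X.Adj i j) = decide (X'.Adj i j))
      (u := []) (v := []) (fun i u v huv => ?_) _ (by simpa using h)
    · have : X = X' := by
        ext i j
        simpa using h'.1 i (List.mem_finRange _) j (List.mem_finRange _)
      rw [this]
      exact ⟨SimpleGraph.Iso.refl⟩
    · have := List.append_inj huv (by simp)
      exact ⟨fun j hj => List.map_inj_left.1 this.1 j hj, this.2⟩

theorem encode_ne_nil {k m : ℕ} {G : Type} [Group G] (e : G ≃ Fin k) (X : SimpleGraph (Fin m)) :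
    encodeGroup e ++ encodeGraph X ≠ [] := by
  simp [encodeGroup, encodeUnary]

/-- A `0`-`1`-matrix, row by row. -/
def matrixWord (n : ℕ) (A : ℕ → ℕ → Bool) : List Bool :=
  (List.range n).flatMap fun i => (List.range n).map (A i)

theorem encodeGraph_eq {n : ℕ} {X : SimpleGraph (Fin n)} {A : ℕ → ℕ → Bool}
    (hA : ∀ i j : Fin n, X.Adj i j ↔ A i j = true) :
    encodeGraph X = encodeUnary n ++ matrixWord n A := by
  classical
  rw [encodeGraph, matrixWord, ← List.map_coe_finRange_eq_range]
  simp only [List.flatMap_map, List.map_map]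
  congr 2
  funext i
  congr 1
  funext j
  rw [Function.comp_apply, Bool.eq_iff_iff, decide_eq_true_iff]
  exact hA i j

/-- The numbers below `p * N` are the `c * N + i` with `c < p` and `i < N`, in lexicographic order.
-/
theorem flatMap_range_mul {α : Type*} (p N : ℕ) (f : ℕ → List α) :
    (List.range (p * N)).flatMap f =
      (List.range p).flatMap fun c => (List.range N).flatMap fun i => f (c * N + i) := by
  induction p with
  | zero => simp
  | succ p ih =>
    rw [add_mul, one_mul, List.range_add, List.range_succ, List.flatMap_append, ih,
      List.flatMap_append]
    simp [List.flatMap_map]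

theorem map_range_mul {α : Type*} (p N : ℕ) (f : ℕ → α) :
    (List.range (p * N)).map f =
      (List.range p).flatMap fun c => (List.range N).map fun i => f (c * N + i) := by
  have := flatMap_range_mul p N fun k => [f k]
  simpa [← List.map_eq_flatMap] using this

theorem matrixWord_eq_map (n : ℕ) (A : ℕ → ℕ → Bool) :
    matrixWord n A = (List.range (n * n)).map fun k => A (k / n) (k % n) := by
  rw [map_range_mul, matrixWord]
  refine List.flatMap_congr fun i _ => List.map_congr_left fun j hj => ?_
  have hj : j < n := List.mem_range.1 hj
  rw [mul_comm i n, Nat.mul_add_div (by omega), Nat.mul_add_mod, Nat.div_eq_of_lt hj,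
    Nat.mod_eq_of_lt hj, add_zero]

theorem length_matrixWord (n : ℕ) (A : ℕ → ℕ → Bool) : (matrixWord n A).length = n * n := by
  simp [matrixWord_eq_map]

/-- Bit `i` of a word, and `0` beyond its end. -/
def bitAt (w : List Bool) (i : ℕ) : Bool := w[i]?.getD false

theorem bitAt_append_right {u v : List Bool} {k : ℕ} (hk : u.length = k) (i : ℕ) :
    bitAt (u ++ v) (k + i) = bitAt v i := by
  rw [bitAt, bitAt, List.getElem?_append_right (by omega)]
  congr 2
  omega

theorem bitAt_append_left {u v : List Bool} {i : ℕ} (hi : i < u.length) :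
    bitAt (u ++ v) i = bitAt u i := by
  simp [bitAt, List.getElem?_append_left hi]

theorem add_mul_lt {n i j : ℕ} (hi : i < n) (hj : j < n) : i * n + j < n * n := by
  have : (i + 1) * n ≤ n * n := Nat.mul_le_mul_right n hi
  rw [add_mul, one_mul] at this
  omega

theorem bitAt_matrixWord {n i j : ℕ} (A : ℕ → ℕ → Bool) (hi : i < n) (hj : j < n) :
    bitAt (matrixWord n A) (i * n + j) = A i j := by
  rw [matrixWord_eq_map, bitAt, List.getElem?_map, List.getElem?_range (add_mul_lt hi hj)]
  simp only [Option.map_some, Option.getD_some]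
  rw [mul_comm i n, Nat.mul_add_div (by omega), Nat.mul_add_mod, Nat.div_eq_of_lt hj,
    Nat.mod_eq_of_lt hj, add_zero]

/-- The part of length `k` of a word that begins at index `o`. -/
def slice (w : List Bool) (o k : ℕ) : List Bool := (List.range k).map fun i => bitAt w (o + i)

theorem slice_zero (w : List Bool) : slice w 0 w.length = w := by
  apply List.ext_getElem
  · simp [slice]
  · intro i h1 h2
    simp [slice, bitAt, h2]

theorem slice_add (w : List Bool) (o a b : ℕ) :
    slice w o (a + b) = slice w o a ++ slice w (o + a) b := by
  simp [slice, List.range_add, add_assoc]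

theorem slice_mul (w : List Bool) (o n : ℕ) :
    slice w o (n * n) = matrixWord n fun i j => bitAt w (o + (i * n + j)) := by
  rw [slice, map_range_mul]
  rfl

/-- At index `o` the word carries `1ⁿ0` followed by the adjacency matrix of a graph on
`n` vertices. -/
structure CarriesGraph (w : List Bool) (o n : ℕ) : Prop where
  one : ∀ i < n, bitAt w (o + i) = true
  zero : bitAt w (o + n) = false
  symm : ∀ i < n, ∀ j < n,
    bitAt w (o + (n + 1) + (i * n + j)) = bitAt w (o + (n + 1) + (j * n + i))
  irrefl : ∀ i < n, bitAt w (o + (n + 1) + (i * n + i)) = false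

/-- The length of the encoding of a graph on `n` vertices. -/
def codeLength (n : ℕ) : ℕ := n + 1 + n * n

/-- The graph on `n` vertices that a word carries at index `o`. -/
def graphAt (w : List Bool) (o n : ℕ) : SimpleGraph (Fin n) :=
  SimpleGraph.fromRel fun i j => bitAt w (o + (n + 1) + (i * n + j)) = true

/-- `graphAt` symmetrises the matrix and removes loops in order to make sense for every word; for a
word that carries a graph this changes nothing. -/
theorem CarriesGraph.adj {w : List Bool} {o n : ℕ} (h : CarriesGraph w o n) (i j : Fin n) :
    (graphAt w o n).Adj i j ↔ bitAt w (o + (n + 1) + (i * n + j)) = true := by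
  rw [graphAt, SimpleGraph.fromRel_adj, h.symm j j.2 i i.2, or_self, and_iff_right_iff_imp]
  rintro hij rfl
  rw [h.irrefl i i.2] at hij
  simp at hij

theorem CarriesGraph.slice_eq {w : List Bool} {o n : ℕ} (h : CarriesGraph w o n) :
    slice w o (codeLength n) = encodeGraph (graphAt w o n) := by
  rw [encodeGraph_eq (A := fun i j => bitAt w (o + (n + 1) + (i * n + j))) h.adj, codeLength,
    slice_add, slice_mul, slice_add]
  congr 1
  rw [encodeUnary]
  congr 1
  · rw [slice, List.eq_replicate_iff]
    refine ⟨by simp, fun b hb => ?_⟩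
    obtain ⟨i, hi, rfl⟩ := List.mem_map.1 hb
    exact h.one i (List.mem_range.1 hi)
  · simp [slice, h.zero]

theorem carriesGraph_of_append {u v w : List Bool} {o n : ℕ} {X : SimpleGraph (Fin n)}
    (hw : w = u ++ (encodeGraph X ++ v)) (ho : u.length = o) :
    CarriesGraph w o n ∧ graphAt w o n = X := by
  classical
  let A : ℕ → ℕ → Bool := fun i j => decide (∃ (hi : i < n) (hj : j < n), X.Adj ⟨i, hi⟩ ⟨j, hj⟩)
  have hA : ∀ i j : Fin n, X.Adj i j ↔ A i j = true := fun i j => by simp [A]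
  rw [encodeGraph_eq hA, encodeUnary] at hw
  have hone : ∀ i < n, bitAt w (o + i) = true := by
    intro i hi
    rw [hw, bitAt_append_right ho, List.append_assoc, List.append_assoc,
      bitAt_append_left (by simpa using hi)]
    simp [bitAt, hi]
  have hzero : bitAt w (o + n) = false := by
    rw [hw, bitAt_append_right ho, List.append_assoc, List.append_assoc]
    have := bitAt_append_right (u := List.replicate n true) (v := [false] ++ (matrixWord n A ++ v))
      (List.length_replicate ..) 0
    rw [add_zero] at this
    exact this
  have hmat : ∀ i < n, ∀ j < n, bitAt w (o + (n + 1) + (i * n + j)) = A i j := by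
    intro i hi j hj
    rw [hw, add_assoc, bitAt_append_right ho, List.append_assoc, bitAt_append_right (by simp),
      bitAt_append_left (by rw [length_matrixWord]; exact add_mul_lt hi hj),
      bitAt_matrixWord A hi hj]
  have hc : CarriesGraph w o n := by
    refine ⟨hone, hzero, fun i hi j hj => ?_, fun i hi => ?_⟩
    · rw [hmat i hi j hj, hmat j hj i hi, Bool.eq_iff_iff,
        ← hA ⟨i, hi⟩ ⟨j, hj⟩, ← hA ⟨j, hj⟩ ⟨i, hi⟩]
      exact X.adj_comm _ _
    · rw [hmat i hi i hi, Bool.eq_false_iff, ne_eq, ← hA ⟨i, hi⟩ ⟨i, hi⟩]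
      exact X.loopless.irrefl _
  refine ⟨hc, ?_⟩
  ext i j
  rw [hc.adj, hmat i i.2 j j.2, ← hA]

/-- The word encodes graphs on `n` and on `m` vertices. -/
structure Parses (w : List Bool) (n m : ℕ) : Prop where
  length : w.length = codeLength n + codeLength m
  fst : CarriesGraph w 0 n
  snd : CarriesGraph w (codeLength n) m

theorem Parses.eq_append {w : List Bool} {n m : ℕ} (h : Parses w n m) :
    w = encodeGraph (graphAt w 0 n) ++ encodeGraph (graphAt w (codeLength n) m) := by
  rw [← h.fst.slice_eq, ← h.snd.slice_eq]
  have := slice_add w 0 (codeLength n) (codeLength m)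
  rw [← h.length, slice_zero, zero_add] at this
  exact this

theorem length_encodeGraph {n : ℕ} (X : SimpleGraph (Fin n)) :
    (encodeGraph X).length = codeLength n := by
  simp [encodeGraph, encodeUnary, codeLength]
  omega

theorem parses_append {n m : ℕ} (X : SimpleGraph (Fin n)) (Y : SimpleGraph (Fin m)) :
    Parses (encodeGraph X ++ encodeGraph Y) n m ∧
      graphAt (encodeGraph X ++ encodeGraph Y) 0 n = X ∧
      graphAt (encodeGraph X ++ encodeGraph Y) (codeLength n) m = Y := by
  obtain ⟨h1, h2⟩ := carriesGraph_of_append (u := []) (v := encodeGraph Y)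
    (w := encodeGraph X ++ encodeGraph Y) (X := X) rfl rfl
  obtain ⟨h3, h4⟩ := carriesGraph_of_append (u := encodeGraph X) (v := [])
    (w := encodeGraph X ++ encodeGraph Y) (X := Y) (by simp) (length_encodeGraph X)
  exact ⟨⟨by simp [length_encodeGraph], h1, h3⟩, h2, h4⟩

/-- The multiplication table of the cyclic group of order `p`. -/
def cyclicWord (p : ℕ) : List Bool :=
  encodeUnary p ++ (List.range p).flatMap fun i => (List.range p).flatMap fun j =>
    encodeUnary ((i + j) % p)

/-- The standard enumeration of the cyclic group of order `q + 1`. -/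
def cyclicEquiv (q : ℕ) : Multiplicative (ZMod (q + 1)) ≃ Fin (q + 1) := Multiplicative.toAdd

theorem encodeGroup_cyclicEquiv (q : ℕ) : encodeGroup (cyclicEquiv q) = cyclicWord (q + 1) := by
  have hval : ∀ i j : Fin (q + 1), (cyclicEquiv q ((cyclicEquiv q).symm i *
      (cyclicEquiv q).symm j)).val = (i.val + j.val) % (q + 1) := fun i j => Fin.val_add i j
  simp only [encodeGroup, cyclicWord, hval, ← List.map_coe_finRange_eq_range, List.flatMap_map]

/-- The adjacency matrix of the disjoint union of `p` graphs on `N` vertices. -/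
def unionWord (p N : ℕ) (A : ℕ → ℕ → ℕ → Bool) : List Bool :=
  encodeUnary (p * N) ++ (List.range p).flatMap fun c => (List.range N).flatMap fun i =>
    (List.range p).flatMap fun d => (List.range N).map fun j => decide (c = d) && A c i j

theorem exists_encodeGraph_eq_unionWord {q N : ℕ} {X Y : SimpleGraph (Fin N)}
    {A : ℕ → ℕ → ℕ → Bool} (hX : ∀ c < q, ∀ i j : Fin N, X.Adj i j ↔ A c i j = true)
    (hY : ∀ i j : Fin N, Y.Adj i j ↔ A q i j = true) :
    ∃ Z : SimpleGraph (Fin ((q + 1) * N)), encodeGraph Z = unionWord (q + 1) N A ∧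
      Nonempty (glue q X Y ≃g Z) := by
  -- The vertex `(c, i)` gets the number `c * N + i`, so the rows and columns of the matrix appear
  -- in the order of the nested loops in `unionWord`.
  let Z : SimpleGraph (Fin ((q + 1) * N)) := (glue q X Y).map finProdFinEquiv.toEmbedding
  let φ : glue q X Y ≃g Z := SimpleGraph.Iso.map finProdFinEquiv (glue q X Y)
  refine ⟨Z, ?_, ⟨φ⟩⟩
  rw [encodeGraph_eq (A := fun a b => decide (a / N = b / N) && A (a / N) (a % N) (b % N)) ?_,
    unionWord]
  · congr 1
    rw [matrixWord, flatMap_range_mul]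
    refine List.flatMap_congr fun c _ => List.flatMap_congr fun i hi => ?_
    rw [map_range_mul]
    refine List.flatMap_congr fun d _ => List.map_congr_left fun j hj => ?_
    have hi : i < N := List.mem_range.1 hi
    have hj : j < N := List.mem_range.1 hj
    rw [mul_comm c N, mul_comm d N, Nat.mul_add_div (by omega), Nat.mul_add_div (by omega),
      Nat.mul_add_mod, Nat.mul_add_mod, Nat.div_eq_of_lt hi, Nat.mod_eq_of_lt hi,
      Nat.div_eq_of_lt hj, Nat.mod_eq_of_lt hj, add_zero, add_zero]
  · intro a b
    obtain ⟨⟨c, i⟩, rfl⟩ := finProdFinEquiv.surjective a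
    obtain ⟨⟨d, j⟩, rfl⟩ := finProdFinEquiv.surjective b
    have hadj : Z.Adj (finProdFinEquiv (c, i)) (finProdFinEquiv (d, j)) ↔
        (glue q X Y).Adj (c, i) (d, j) := φ.map_rel_iff
    have hval : ∀ (c : Fin (q + 1)) (i : Fin N),
        (finProdFinEquiv (c, i)).val / N = c ∧ (finProdFinEquiv (c, i)).val % N = i := by
      intro c i
      have hi := i.2
      rw [finProdFinEquiv_apply_val]
      constructor
      · rw [add_comm, Nat.mul_add_div (by omega), Nat.div_eq_of_lt hi, add_zero]
      · rw [add_comm, Nat.mul_add_mod, Nat.mod_eq_of_lt hi]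
    rw [hadj, (hval c i).1, (hval c i).2, (hval d j).1, (hval d j).2, Bool.and_eq_true,
      decide_eq_true_iff, Fin.val_inj]
    refine and_congr_right fun _ => ?_
    by_cases hc : c = Fin.last q
    · subst hc
      simpa using hY i j
    · have : c.val < q := by
        have h1 := c.2
        have h2 : c.val ≠ q := fun h => hc (Fin.ext h)
        omega
      simpa [hc] using hX c this i j

/-! ### Logical operations in the language -/

namespace Ex

variable {w : List Bool} {env : ℕ → ℕ}

/-- Truth of an expression. -/
def Holds (w : List Bool) (env : ℕ → ℕ) (φ : Ex) : Prop := φ.eval w env ≠ 0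

instance (w : List Bool) (env : ℕ → ℕ) (φ : Ex) : Decidable (φ.Holds w env) :=
  inferInstanceAs (Decidable (_ ≠ _))

/-- Negation. -/
def not (φ : Ex) : Ex := eq φ (const 0)

/-- Bounded universal quantification. -/
def all (x : ℕ) (a φ : Ex) : Ex := eq (find x a φ.not) a

theorem holds_eq {a b : Ex} : (eq a b).Holds w env ↔ a.eval w env = b.eval w env := by
  simp [Holds, eval]

theorem holds_lt {a b : Ex} : (lt a b).Holds w env ↔ a.eval w env < b.eval w env := by
  simp [Holds, eval]

theorem holds_bit {a : Ex} : (bit a).Holds w env ↔ bitAt w (a.eval w env) = true := by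
  simp [Holds, eval, bitAt]

theorem holds_bit_eq_bit {a b : Ex} : (eq (bit a) (bit b)).Holds w env ↔
    bitAt w (a.eval w env) = bitAt w (b.eval w env) := by
  rw [holds_eq]
  change (bitAt w _).toNat = (bitAt w _).toNat ↔ _
  cases bitAt w (a.eval w env) <;> cases bitAt w (b.eval w env) <;> simp

theorem holds_not {φ : Ex} : φ.not.Holds w env ↔ ¬ φ.Holds w env := by
  by_cases h : φ.eval w env = 0 <;> simp [Holds, not, eval, h]

theorem holds_mul {φ ψ : Ex} : (mul φ ψ).Holds w env ↔ φ.Holds w env ∧ ψ.Holds w env := by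
  simp [Holds, eval]

theorem holds_add {φ ψ : Ex} : (add φ ψ).Holds w env ↔ φ.Holds w env ∨ ψ.Holds w env := by
  simp only [Holds, eval]
  omega

/-- The search for a counterexample returns its bound exactly if there is none. -/
theorem holds_all {x : ℕ} {a φ : Ex} :
    (all x a φ).Holds w env ↔ ∀ i < a.eval w env, φ.Holds w (Function.update env x i) := by
  rw [all, holds_eq, eval]
  constructor
  · intro h i hi
    rw [← h] at hi
    have := eq_zero_of_lt_leastBelow hi
    exact not_not.1 fun hn => (holds_not.2 hn) this
  · intro h
    refine leastBelow_eq le_rfl (fun i hi => ?_) (fun h => absurd h (lt_irrefl _))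
    exact not_not.1 fun hn => holds_not.1 hn (h i hi)

end Ex

namespace WordProg

variable {w : List Bool} {env : ℕ → ℕ}

/-- Write a number in unary; the variable `9` is used. -/
def unary (a : Ex) : WordProg := seq (loop 9 a (emit true)) (emit false)

theorem eval_unary {a : Ex} : (unary a).eval w env = encodeUnary (a.eval w env) := by
  simp only [unary, eval, encodeUnary]
  congr 1
  rw [List.eq_replicate_iff]
  constructor
  · simp
  · intro b hb
    simpa using (List.mem_flatMap.1 hb).choose_spec.2

theorem eval_ite {φ : Ex} {p q : WordProg} : (ite φ p q).eval w env =
    if φ.Holds w env then p.eval w env else q.eval w env := by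
  by_cases h : φ.eval w env = 0 <;> simp [eval, Ex.Holds, h]

theorem eval_seq {p q : WordProg} : (seq p q).eval w env = p.eval w env ++ q.eval w env := rfl

theorem eval_loop {x : ℕ} {a : Ex} {p : WordProg} : (loop x a p).eval w env =
    (List.range (a.eval w env)).flatMap fun i => p.eval w (Function.update env x i) := rfl

/-- Write a truth value. -/
def truth (φ : Ex) : WordProg := ite φ (emit true) (emit false)

theorem eval_truth {φ : Ex} : (truth φ).eval w env = [decide (φ.Holds w env)] := by
  by_cases h : φ.Holds w env <;> simp [truth, eval_ite, eval, h]

end WordProg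

/-! ### The reduction

The variables `0`, `1` and `2` hold the numbers of vertices of the two graphs and the prime. -/

namespace GraphReduction

open Ex WordProg

/-- The length of the encoding of a graph on `a` vertices. -/
def codeLengthEx (a : Ex) : Ex := add (add a (const 1)) (mul a a)

/-- The number of ones that begin at index `a`. -/
def onesEx (a : Ex) : Ex := find 3 len (bit (add a (var 3))).not

/-- The index of the entry of the adjacency matrix in row `i` and column `j`, for the graph on `k`
vertices that begins at index `o`. -/
def entryEx (o k i j : Ex) : Ex := add (add o (add k (const 1))) (add (mul i k) j)

/-- The matrix of the graph on `k` vertices that begins at index `o` is symmetric with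
zero diagonal. -/
def symmEx (o k : Ex) : Ex :=
  all 3 k (mul (bit (entryEx o k (var 3) (var 3))).not (all 4 k
    (eq (bit (entryEx o k (var 3) (var 4))) (bit (entryEx o k (var 4) (var 3))))))

/-- The input encodes two graphs. -/
def validEx : Ex :=
  mul (eq len (add (codeLengthEx (var 0)) (codeLengthEx (var 1))))
    (mul (symmEx (const 0) (var 0)) (symmEx (codeLengthEx (var 0)) (var 1)))

/-- The least prime greater than `n + 1`. -/
def primeEx : Ex :=
  find 3 (add (mul (const 2) (add (var 0) (const 1))) (const 1))
    (mul (lt (add (var 0) (const 1)) (var 3)) (all 4 (var 3) (all 5 (var 3)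
      (eq (mul (var 4) (var 5)) (var 3)).not)))

/-- The multiplication table of the cyclic group. -/
def groupProg : WordProg :=
  seq (unary (var 2)) (loop 3 (var 2) (loop 4 (var 2)
    (ite (lt (add (var 3) (var 4)) (var 2)) (unary (add (var 3) (var 4)))
      (unary (find 5 (var 2) (eq (add (var 5) (var 2)) (add (var 3) (var 4))))))))

/-- Adjacency of the vertices `(c, i)` and `(d, j)`, which are in the variables `3`, …, `6`. -/
def adjEx : Ex :=
  mul (eq (var 3) (var 5)) (mul (eq (var 4) (var 6)).not
    (add (add (eq (var 4) (var 0)) (eq (var 6) (var 0)))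
      (add (mul (lt (add (var 3) (const 1)) (var 2))
          (bit (entryEx (const 0) (var 0) (var 4) (var 6))))
        (mul (lt (add (var 3) (const 1)) (var 2)).not
          (bit (entryEx (codeLengthEx (var 0)) (var 0) (var 4) (var 6)))))))

/-- The adjacency matrix of the disjoint union of the cones. -/
def graphProg : WordProg :=
  seq (unary (mul (var 2) (add (var 0) (const 1))))
    (loop 3 (var 2) (loop 4 (add (var 0) (const 1))
      (loop 5 (var 2) (loop 6 (add (var 0) (const 1)) (truth adjEx)))))

/-- The reduction of graph isomorphism to representability. -/
def prog : WordProg :=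
  letIn 0 (onesEx (const 0)) (letIn 1 (onesEx (codeLengthEx (var 0))) (ite validEx
    (letIn 2 primeEx (seq groupProg (ite (eq (var 0) (var 1)) graphProg (emit false)))) nil))

variable {w : List Bool} {env : ℕ → ℕ}

theorem holds_symmEx_fst : (symmEx (const 0) (var 0)).Holds w env ↔
    ∀ i < env 0, bitAt w (0 + (env 0 + 1) + (i * env 0 + i)) = false ∧ ∀ j < env 0,
      bitAt w (0 + (env 0 + 1) + (i * env 0 + j)) =
        bitAt w (0 + (env 0 + 1) + (j * env 0 + i)) := by
  simp [symmEx, entryEx, holds_all, holds_mul, holds_not, holds_bit, holds_bit_eq_bit,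
    Ex.eval]

theorem holds_symmEx_snd : (symmEx (codeLengthEx (var 0)) (var 1)).Holds w env ↔
    ∀ i < env 1, bitAt w (codeLength (env 0) + (env 1 + 1) + (i * env 1 + i)) = false ∧
      ∀ j < env 1, bitAt w (codeLength (env 0) + (env 1 + 1) + (i * env 1 + j)) =
        bitAt w (codeLength (env 0) + (env 1 + 1) + (j * env 1 + i)) := by
  simp [symmEx, entryEx, codeLengthEx, codeLength, holds_all, holds_mul, holds_not, holds_bit,
    holds_bit_eq_bit, Ex.eval]

theorem holds_validEx : validEx.Holds w env ↔
    w.length = codeLength (env 0) + codeLength (env 1) ∧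
      (symmEx (const 0) (var 0)).Holds w env ∧
      (symmEx (codeLengthEx (var 0)) (var 1)).Holds w env := by
  simp [validEx, holds_mul, holds_eq, Ex.eval, codeLengthEx, codeLength]

/-- No assumption is made on the word: the count is meaningful for malformed input too, except that
an unsuccessful search returns `w.length`. The assumption on `a` says that the search variable `3`
does not affect its value. -/
theorem onesEx_spec {a : Ex} {o : ℕ} (ha : ∀ i, a.eval w (Function.update env 3 i) = o) :
    (∀ i < (onesEx a).eval w env, bitAt w (o + i) = true) ∧
      ((onesEx a).eval w env < w.length → bitAt w (o + (onesEx a).eval w env) = false) := by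
  have hbit : ∀ i, (bit (add a (var 3))).not.eval w (Function.update env 3 i) ≠ 0 ↔
      bitAt w (o + i) = false := by
    intro i
    have := holds_not (φ := bit (add a (var 3))) (w := w) (env := Function.update env 3 i)
    rw [holds_bit, Ex.eval, ha i, Ex.eval, Function.update_self, Bool.not_eq_true] at this
    exact this
  constructor
  · intro i hi
    have h0 : (bit (add a (var 3))).not.eval w (Function.update env 3 i) = 0 :=
      eq_zero_of_lt_leastBelow (f := fun i => (bit (add a (var 3))).not.eval w _) hi
    have := (hbit i).not.1 (not_not.2 h0)
    simpa using this
  · intro h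
    exact (hbit _).1 (leastBelow_ne_zero
      (f := fun i => (bit (add a (var 3))).not.eval w (Function.update env 3 i)) h)

theorem eval_onesEx {a : Ex} {o k : ℕ} (ha : ∀ i, a.eval w (Function.update env 3 i) = o)
    (h : CarriesGraph w o k) (hk : k < w.length) : (onesEx a).eval w env = k := by
  obtain ⟨h1, h2⟩ := onesEx_spec (w := w) (env := env) ha
  rcases lt_trichotomy ((onesEx a).eval w env) k with hlt | heq | hgt
  · have h3 := h2 (hlt.trans hk)
    rw [h.one _ hlt] at h3
    simp at h3
  · exact heq
  · have h3 := h1 k hgt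
    rw [h.zero] at h3
    simp at h3

/-- Bertrand's postulate for `env 0 + 1` puts a prime below the search bound, so the search
succeeds. Primality is tested as the absence of a factorisation into two smaller numbers, which is
correct because the candidates exceed `1`. -/
theorem eval_primeEx : (primeEx.eval w env).Prime ∧ env 0 + 1 < primeEx.eval w env := by
  have hP : ∀ x, (mul (lt (add (var 0) (const 1)) (var 3)) (all 4 (var 3) (all 5 (var 3)
      (eq (mul (var 4) (var 5)) (var 3)).not))).Holds w (Function.update env 3 x) ↔
      env 0 + 1 < x ∧ x.Prime := by
    intro x
    simp only [holds_mul, holds_lt, holds_all, holds_not, holds_eq, Ex.eval]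
    simp only [ne_eq, OfNat.zero_ne_ofNat, Nat.reduceEqDiff, not_false_eq_true,
      Function.update_of_ne, Function.update_self]
    refine and_congr_right fun hx => ?_
    rw [← not_iff_not, Nat.not_prime_iff_exists_mul_eq (by omega)]
    push Not
    constructor
    · rintro ⟨a, ha, b, hb, h⟩
      exact ⟨a, b, ha, hb, h⟩
    · rintro ⟨a, b, ha, hb, h⟩
      exact ⟨a, ha, b, hb, h⟩
  obtain ⟨p, hp, hlt, hle⟩ := Nat.exists_prime_lt_and_le_two_mul (env 0 + 1) (Nat.succ_ne_zero _)
  have hbelow : primeEx.eval w env < 2 * (env 0 + 1) + 1 := by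
    by_contra hge
    have hlt' : p < primeEx.eval w env := by omega
    exact ((hP p).2 ⟨hlt, hp⟩) (eq_zero_of_lt_leastBelow (f := fun i => Ex.eval w _ _) hlt')
  exact ((hP _).1 (leastBelow_ne_zero (f := fun i => Ex.eval w _ _) hbelow)).symm

theorem eval_groupProg : groupProg.eval w env = cyclicWord (env 2) := by
  simp only [groupProg, eval_seq, eval_loop, eval_unary, eval_ite, cyclicWord, holds_lt, Ex.eval]
  congr 1
  refine List.flatMap_congr fun i hi => ?_
  simp only [ne_eq, Nat.reduceEqDiff, not_false_eq_true, Function.update_of_ne]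
  refine List.flatMap_congr fun j hj => ?_
  rw [List.mem_range] at hi hj
  simp only [Function.update_self]
  split_ifs with h
  · rw [Nat.mod_eq_of_lt h]
  · congr 1
    -- Both summands are less than the modulus, so one subtraction reduces the sum; the language has
    -- none, and the difference is found by search.
    rw [Nat.mod_eq_sub_mod (by omega), Nat.mod_eq_of_lt (by omega)]
    refine leastBelow_eq (by omega) (fun k hk => if_neg (by omega)) (fun hk => ?_)
    rw [if_pos (by omega)]
    exact one_ne_zero

open Classical in
/-- Adjacency of `i` and `j` in copy `c`. -/
noncomputable def adjBit (w : List Bool) (n p c i j : ℕ) : Bool :=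
  decide (i ≠ j ∧ ((i = n ∨ j = n) ∨
    (c + 1 < p ∧ bitAt w (0 + (n + 1) + (i * n + j)) = true) ∨
    (¬ c + 1 < p ∧ bitAt w (codeLength n + (n + 1) + (i * n + j)) = true)))

theorem eval_graphProg :
    graphProg.eval w env = unionWord (env 2) (env 0 + 1) (adjBit w (env 0) (env 2)) := by
  simp only [graphProg, eval_seq, eval_loop, eval_unary, eval_truth, unionWord]
  simp only [Ex.eval, ne_eq, Nat.reduceEqDiff, not_false_eq_true, Function.update_of_ne,
    OfNat.zero_ne_ofNat]
  congr 1
  refine List.flatMap_congr fun c _ => List.flatMap_congr fun i _ =>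
    List.flatMap_congr fun d _ => ?_
  rw [List.map_eq_flatMap]
  refine List.flatMap_congr fun j _ => ?_
  congr 1
  rw [Bool.eq_iff_iff, decide_eq_true_iff, Bool.and_eq_true, adjBit, decide_eq_true_iff,
    decide_eq_true_iff]
  simp [adjEx, entryEx, codeLengthEx, codeLength, holds_mul, holds_add, holds_eq, holds_not,
    holds_lt, holds_bit, Ex.eval]

/-- The word `encodeUnary 0` is the code of the graph without vertices, which settles the case of
different sizes negatively. -/
theorem eval_prog_of_parses {n m : ℕ} (h : Parses w n m) :
    ∃ p, p.Prime ∧ n + 1 < p ∧ prog.eval w (fun _ => 0) =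
      cyclicWord p ++ if n = m then unionWord p (n + 1) (adjBit w n p) else encodeUnary 0 := by
  have hlen := h.length
  simp only [codeLength] at hlen
  have h1 : (onesEx (const 0)).eval w (fun _ => 0) = n :=
    eval_onesEx (fun _ => rfl) h.fst (by omega)
  have h2 : (onesEx (codeLengthEx (var 0))).eval w (Function.update (fun _ => 0) 0 n) = m :=
    eval_onesEx (o := codeLength n) (fun i => by simp [codeLengthEx, codeLength, Ex.eval]) h.snd
      (by omega)
  let env := Function.update (Function.update (fun _ => 0) 0 n) 1 m
  have e0 : env 0 = n := by simp [env]
  have e1 : env 1 = m := by simp [env]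
  have hv : validEx.Holds w env := by
    rw [holds_validEx, holds_symmEx_fst, holds_symmEx_snd, e0, e1]
    exact ⟨h.length, fun i hi => ⟨h.fst.irrefl i hi, h.fst.symm i hi⟩,
      fun i hi => ⟨h.snd.irrefl i hi, h.snd.symm i hi⟩⟩
  obtain ⟨hp, hlt⟩ := eval_primeEx (w := w) (env := env)
  rw [e0] at hlt
  refine ⟨primeEx.eval w env, hp, hlt, ?_⟩
  generalize hpe : primeEx.eval w env = p
  let env' := Function.update env 2 p
  have e0' : env' 0 = n := by simp [env', e0]
  have e1' : env' 1 = m := by simp [env', e1]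
  have e2' : env' 2 = p := by simp [env']
  rw [prog, WordProg.eval, h1, WordProg.eval, h2, eval_ite, if_pos hv, WordProg.eval, hpe,
    WordProg.eval, eval_ite, eval_groupProg, eval_graphProg]
  change cyclicWord (env' 2) ++ (if (eq (var 0) (var 1)).Holds w env' then
    unionWord (env' 2) (env' 0 + 1) (adjBit w (env' 0) (env' 2)) else [false]) = _
  simp only [holds_eq, Ex.eval, e0', e1', e2']
  rfl

theorem exists_parses_of_eval_prog_ne_nil (h : prog.eval w (fun _ => 0) ≠ []) :
    ∃ n m, Parses w n m := by
  rw [prog, WordProg.eval, WordProg.eval, eval_ite] at h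
  have h1 := onesEx_spec (w := w) (env := fun _ => 0) (a := const 0) (o := 0) fun _ => rfl
  generalize (onesEx (const 0)).eval w (fun _ => 0) = n at h h1
  have h2 := onesEx_spec (w := w) (env := Function.update (fun _ => 0) 0 n)
    (a := codeLengthEx (var 0)) (o := codeLength n)
    fun i => by simp [codeLengthEx, codeLength, Ex.eval]
  generalize (onesEx (codeLengthEx (var 0))).eval w (Function.update (fun _ => 0) 0 n) = m at h h2
  refine ⟨n, m, ?_⟩
  split_ifs at h with hv
  · rw [holds_validEx, holds_symmEx_fst, holds_symmEx_snd] at hv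
    simp only [Function.update_self, ne_eq, zero_ne_one, not_false_eq_true,
      Function.update_of_ne] at hv
    obtain ⟨hlen, hf, hs⟩ := hv
    have hlen' := hlen
    simp only [codeLength] at hlen'
    -- The program never tests the `0` after a block of ones. The length equation puts its index
    -- inside the word, and so the search for a `0` has succeeded.
    exact ⟨hlen,
      ⟨h1.1, h1.2 (by omega), fun i hi => (hf i hi).2, fun i hi => (hf i hi).1⟩,
      ⟨h2.1, h2.2 (by omega), fun i hi => (hs i hi).2, fun i hi => (hs i hi).1⟩⟩
  · exact absurd rfl h

end GraphReduction

/-- If `i` or `j` is the apex, `A i j` refers to a place outside the adjacency matrix and may be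
anything. The disjunct for the apex makes its value irrelevant. -/
theorem cone_adj_iff {n : ℕ} {X : SimpleGraph (Fin n)} {A : ℕ → ℕ → Prop}
    (hA : ∀ a b : Fin n, X.Adj a b ↔ A a b) (i j : Fin (n + 1)) :
    (cone X).Adj i j ↔ i.val ≠ j.val ∧ ((i.val = n ∨ j.val = n) ∨ A i j) := by
  induction i using Fin.lastCases with
  | last => simp [cone_adj_last, Fin.ext_iff, eq_comm]
  | cast a =>
    induction j using Fin.lastCases with
    | last =>
      rw [SimpleGraph.adj_comm, cone_adj_last]
      simp [Fin.ext_iff]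
    | cast b =>
      rw [cone_adj_castSucc, hA]
      have ha : a.castSucc.val ≠ n := a.2.ne
      have hb : b.castSucc.val ≠ n := b.2.ne
      simp only [ha, hb, or_self, false_or]
      refine ⟨fun h => ⟨fun hab => ?_, h⟩, fun h => h.2⟩
      rw [← hA] at h
      exact h.ne (Fin.ext hab)

namespace GraphReduction

theorem exists_encode_eq {w : List Bool} {n m : ℕ} (h : Parses w n m) :
    ∃ (q M : ℕ) (Z : SimpleGraph (Fin M)), (q + 1).Prime ∧
      prog.eval w (fun _ => 0) = encodeGroup (cyclicEquiv q) ++ encodeGraph Z ∧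
      (Representable (Multiplicative (ZMod (q + 1))) Z ↔
        Nonempty (graphAt w 0 n ≃g graphAt w (codeLength n) m)) := by
  obtain ⟨p, hp, hnp, hw⟩ := eval_prog_of_parses h
  obtain ⟨q, rfl⟩ : ∃ q, p = q + 1 := ⟨p - 1, by omega⟩
  rw [← encodeGroup_cyclicEquiv] at hw
  by_cases hnm : n = m
  · subst hnm
    rw [if_pos rfl] at hw
    have hX : ∀ c < q, ∀ i j, (cone (graphAt w 0 n)).Adj i j ↔
        adjBit w n (q + 1) c i j = true := by
      intro c hc i j
      rw [cone_adj_iff h.fst.adj (A := fun i j => bitAt w (0 + (n + 1) + (i * n + j)) = true),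
        adjBit, decide_eq_true_iff]
      simp [hc]
    have hY : ∀ i j, (cone (graphAt w (codeLength n) n)).Adj i j ↔
        adjBit w n (q + 1) q i j = true := by
      intro i j
      rw [cone_adj_iff h.snd.adj
        (A := fun i j => bitAt w (codeLength n + (n + 1) + (i * n + j)) = true),
        adjBit, decide_eq_true_iff]
      simp
    obtain ⟨Z, hZ, ⟨φ⟩⟩ := exists_encodeGraph_eq_unionWord hX hY
    refine ⟨q, _, Z, hp, by rw [hw, hZ], ?_⟩
    -- The criterion is applied to the cones, which have `n + 1` vertices; hence the prime had to
    -- exceed `n + 1`.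
    rw [← nonempty_cone_iso_iff, ← representable_copies_iff (connected_cone _)
      (connected_cone _) (Fintype.card_fin _) (Fintype.card_fin _) hp hnp]
    exact ⟨fun hr => hr.of_iso ((glueIso q _ _).trans φ).symm,
      fun hr => hr.of_iso ((glueIso q _ _).trans φ)⟩
  · rw [if_neg hnm] at hw
    refine ⟨q, 0, ⊥, hp, by rw [hw]; simp [encodeGraph], ?_⟩
    refine iff_of_false (not_representable_of_isEmpty _) ?_
    rintro ⟨φ⟩
    exact hnm (by simpa using Fintype.card_congr φ.toEquiv)

end GraphReduction

/-- Graph isomorphism reduces to representability for every class of groups that contains the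
cyclic groups of prime order. -/
theorem graphIsomorphism_reduces (𝒞 : ∀ (G : Type) [Group G], Prop)
    (h𝒞 : ∀ p : ℕ, p.Prime → 𝒞 (Multiplicative (ZMod p))) :
    LogspaceReduces graphIsomorphism (groupRepresentability 𝒞) := by
  refine ⟨_, GraphReduction.prog.logspaceComputable, fun w => ⟨?_, ?_⟩, ?_⟩
  · rintro ⟨n, m, X, Y, rfl, hXY⟩
    obtain ⟨hparse, hX, hY⟩ := parses_append X Y
    obtain ⟨q, M, Z, hq, heq, hiff⟩ := GraphReduction.exists_encode_eq hparse
    rw [hX, hY] at hiff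
    exact ⟨q + 1, M, _, _, cyclicEquiv q, Z, heq, h𝒞 _ hq, hiff.2 hXY⟩
  · rintro ⟨k, m', G, _, e, X', heq', -, hrep⟩
    obtain ⟨n, m, hparse⟩ := GraphReduction.exists_parses_of_eval_prog_ne_nil
      (heq'.trans_ne (encode_ne_nil e X'))
    obtain ⟨q, M, Z, -, heq, hiff⟩ := GraphReduction.exists_encode_eq hparse
    -- The group and the graph found in the output are arbitrary witnesses; they are identified with
    -- those written by the program.
    obtain ⟨⟨f⟩, ⟨φ⟩⟩ := encode_inj (heq'.symm.trans heq)
    exact ⟨n, m, _, _, hparse.eq_append, hiff.1 ((hrep.of_iso φ).of_mulEquiv f)⟩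
  · rintro w ⟨n, m, X, Y, rfl⟩
    obtain ⟨q, M, Z, hq, heq, -⟩ := GraphReduction.exists_encode_eq (parses_append X Y).1
    exact ⟨q + 1, M, _, _, cyclicEquiv q, Z, heq, h𝒞 _ hq⟩

theorem mainTheorem1 :
    (∀ (V W : Type*) [Fintype V] [Fintype W] (X : SimpleGraph V) (Y : SimpleGraph W) (n p : ℕ),
      X.Connected → Y.Connected → Fintype.card V = n → Fintype.card W = n →
      p.Prime → n < p →
      (Representable (Multiplicative (ZMod p)) (graphCopies (p - 1) X ⊕g Y) ↔
        Nonempty (X ≃g Y))) ∧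
    LogspaceReduces graphIsomorphism abelianRepresentability ∧
    LogspaceReduces graphIsomorphism primeCyclicRepresentability := by
  refine ⟨?_, ?_, ?_⟩
  · intro V W _ _ X Y n p hX hY hV hW hp hnp
    exact representable_copies_iff hX hY hV hW hp hnp
  · exact graphIsomorphism_reduces _ fun p _ a b => mul_comm a b
  · refine graphIsomorphism_reduces _ fun p hp => ⟨inferInstance, ?_⟩
    rw [Nat.card_congr Multiplicative.toAdd, Nat.card_zmod]
    exact hp
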